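/- All graphs are finite and simple, and $G$ denotes a graph. **Separators.** For $X\subseteq V(G)$ let $N(X)$ be the set of vertices outside $X$ with a neighbour in $X$. A *full component* of $S\subseteq V(G)$ is a connected component $A$ of $G-S$ with $N(A)=S$; $S$ is a *minimal separator* if it has at least two full components. A graph is *mesh* if its complement is not connected. A minimal separator $S$ is *subordinate* if there are a minimal separator $S'\supseteq S$ and two distinct full components $A',B'$ of $S'$ such that some full component of $S$ is disjoint from $A'\cup S'\cup B'$. A minimal separator that is not subordinate is *mesh*, *mixed* or *non-mesh* if exactly $2$, $1$ or $0$, respectively, of its full components induce mesh graphs. A set $\widetilde S\subseteq V(G)$ *carves away* a component $D$ of $G-S$ if no component of $G-\widetilde S$ intersects both $D$ and another component of $G-S$. **Treedepth structures.** In a rooted forest, the depth of a vertex is the number of vertices on its path to the root; each vertex is an ancestor of itself; two vertices are comparable if one is an ancestor of the other; a path is vertical if one of its ends is an ancestor of the other. For $d\ge 1$, a *treedepth-$d$ structure* in $G$ is a rooted forest $\mathcal T$ with $V(\mathcal T)\subseteq V(G)$ in which all depths are at most $d$ and such that any two vertices of $\mathcal T$ adjacent in $G$ are comparable. It is *maximal*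 if there is no treedepth-$d$ structure $\mathcal T'$ in $G$ such that $\mathcal T$ is a proper induced subgraph of $\mathcal T'$ and every root of $\mathcal T$ is a root of $\mathcal T'$. A minimal separator $S$ of $G$ is *$\mathcal T$-avoiding* if $S\cap V(\mathcal T)$ is contained in a vertical path of $\mathcal T$ and contains no vertex of depth $d$. For such $S$, a *$\mathcal T$-carver* for $S$ is a set $\widetilde S\subseteq V(G)$ with $\widetilde S\cap V(\mathcal T)=S\cap V(\mathcal T)$ such that 1. if $S$ is subordinate or non-mesh, then $\widetilde S=S$; 2. if $S$ is mixed, then $\widetilde S$ carves away the mesh full component of $S$; 3. if $S$ is mesh, then $\widetilde S$ carves away every component of $G-S$. **Proposition.** For every positive integer $d$ there is a polynomial-time algorithm that, given a graph $G$ with no induced path on six vertices, returns a collection $\mathcal S\subseteq 2^{V(G)}$ such that for every maximal treedepth-$d$ structure $\mathcal T$ in $G$ and every $\mathcal T$-avoiding minimal separator $S$ of $G$, the collection $\mathcal S$ contains a $\mathcal T$-carver for $S$. -/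

import Mathlib

namespace SepCarving

/-! ### Separators and components -/

section Graphs

variable {V : Type*} (G : SimpleGraph V)

/-- `G` has no induced path on six vertices. -/
def P6Free : Prop := ¬ (SimpleGraph.pathGraph 6).IsIndContained G

/-- The open neighbourhood `N(X)` of a set of vertices. -/
def nbhd (X : Set V) : Set V := {u | u ∉ X ∧ ∃ v ∈ X, G.Adj u v}

/-- `D` is the vertex set of a connected component of `G - S`. -/
def IsComp (S D : Set V) : Prop :=
  ∃ c : (G.induce Sᶜ).ConnectedComponent, D = Subtype.val '' c.supp

/-- `A` is a full component of `S`: a component of `G - S` with `N(A) = S`. -/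
def IsFullComp (S A : Set V) : Prop := IsComp G S A ∧ nbhd G A = S

/-- `S` is a minimal separator: it has at least two full components. -/
def IsMinSep (S : Set V) : Prop :=
  ∃ A B : Set V, A ≠ B ∧ IsFullComp G S A ∧ IsFullComp G S B

/-- The induced subgraph `G[A]` is mesh: its complement is not connected. -/
def IsMeshSet (A : Set V) : Prop := ¬ (G.induce A)ᶜ.Connected

/-- `S` is a subordinate minimal separator. -/
def IsSubordinate (S : Set V) : Prop :=
  IsMinSep G S ∧ ∃ S' A' B' C : Set V,
    IsMinSep G S' ∧ A' ≠ B' ∧ IsFullComp G S' A' ∧ IsFullComp G S' B' ∧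
    S ⊆ S' ∧ IsFullComp G S C ∧ Disjoint C (A' ∪ S' ∪ B')

/-- The full components of `S` that are mesh. -/
def meshFullComps (S : Set V) : Set (Set V) := {A | IsFullComp G S A ∧ IsMeshSet G A}

/-- Mesh minimal separators. -/
def IsMeshSep (S : Set V) : Prop :=
  IsMinSep G S ∧ ¬ IsSubordinate G S ∧ (meshFullComps G S).encard = 2

/-- Mixed minimal separators. -/
def IsMixedSep (S : Set V) : Prop :=
  IsMinSep G S ∧ ¬ IsSubordinate G S ∧ (meshFullComps G S).encard = 1

/-- Non-mesh minimal separators. -/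
def IsNonMeshSep (S : Set V) : Prop :=
  IsMinSep G S ∧ ¬ IsSubordinate G S ∧ (meshFullComps G S).encard = 0

/-- `S'` carves away the component `D` of `G - S`: no component of `G - S'` intersects both `D`
and another component of `G - S`. -/
def CarvesAway (S S' D : Set V) : Prop :=
  ∀ C, IsComp G S' C → (C ∩ D).Nonempty →
    ∀ D', IsComp G S D' → D' ≠ D → ¬ (C ∩ D').Nonempty

end Graphs

/-! ### Rooted forests and treedepth structures -/

/-- A rooted forest with vertices in `V`, given by its parent pointers; the roots are the vertices
without a parent. Well-foundedness says that following parents always ends, at a root. -/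
structure RootedForest (V : Type*) where
  /-- the vertices of the forest -/
  verts : Set V
  /-- the parent of a vertex, if any -/
  parent : V → Option V
  mem_of_parent : ∀ v u, parent v = some u → v ∈ verts ∧ u ∈ verts
  wf : WellFounded fun u v => parent v = some u

namespace RootedForest

variable {V : Type*} (T : RootedForest V)

/-- The roots. -/
def roots : Set V := {v | v ∈ T.verts ∧ T.parent v = none}

/-- Adjacency in the underlying undirected forest. -/
def Adj (u v : V) : Prop := T.parent u = some v ∨ T.parent v = some u

/-- `u` is an ancestor of `v`, i.e. lies on the path from `v` to its root (each vertex is an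
ancestor of itself). -/
def IsAncestor (u v : V) : Prop :=
  v ∈ T.verts ∧ Relation.ReflTransGen (fun x y => T.parent x = some y) v u

/-- The number of vertices on the path from `v` to its root; roots have depth `1`. -/
noncomputable def depth (v : V) : ℕ := {u | T.IsAncestor u v}.ncard

/-- `u` and `v` are joined by a vertical path. -/
def Comparable (u v : V) : Prop := T.IsAncestor u v ∨ T.IsAncestor v u

/-- `X` is contained in (the vertex set of) a vertical path, the one between some vertex `w` and
an ancestor `u` of `w`. (The empty set always qualifies.) -/
def InVerticalPath (X : Set V) : Prop :=
  X = ∅ ∨ ∃ u w, T.IsAncestor u w ∧ X ⊆ {x | T.IsAncestor u x ∧ T.IsAncestor x w}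

/-- `T` is a treedepth-`d` structure in `G`: its height is at most `d` and it is an elimination
forest of the subgraph of `G` induced by its vertices. -/
def IsTDStructure (G : SimpleGraph V) (d : ℕ) : Prop :=
  (∀ v ∈ T.verts, T.depth v ≤ d) ∧
    ∀ u ∈ T.verts, ∀ v ∈ T.verts, G.Adj u v → T.Comparable u v

/-- `T` is a proper induced subgraph of `T'`. -/
def IsProperInduced (T' : RootedForest V) : Prop :=
  T.verts ⊂ T'.verts ∧ ∀ u ∈ T.verts, ∀ v ∈ T.verts, T.Adj u v ↔ T'.Adj u v

/-- `T` is a maximal treedepth-`d` structure in `G`. -/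
def IsMaximalTDStructure (G : SimpleGraph V) (d : ℕ) : Prop :=
  T.IsTDStructure G d ∧
    ¬ ∃ T' : RootedForest V, T'.IsTDStructure G d ∧ T.IsProperInduced T' ∧ T.roots ⊆ T'.roots

/-- `S` is a `T`-avoiding minimal separator of `G` (for a treedepth-`d` structure `T`). -/
def IsAvoidingMinSep (G : SimpleGraph V) (d : ℕ) (S : Set V) : Prop :=
  IsMinSep G S ∧ T.InVerticalPath (S ∩ T.verts) ∧ ∀ v ∈ S ∩ T.verts, T.depth v ≠ d

/-- `S'` is a `T`-carver for the minimal separator `S` of `G`. -/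
def IsCarver (G : SimpleGraph V) (S S' : Set V) : Prop :=
  S' ∩ T.verts = S ∩ T.verts ∧
  (IsSubordinate G S ∨ IsNonMeshSep G S → S' = S) ∧
  (IsMixedSep G S → ∀ A, IsFullComp G S A → IsMeshSet G A → CarvesAway G S S' A) ∧
  (IsMeshSep G S → ∀ D, IsComp G S D → CarvesAway G S S' D)

end RootedForest

/-! ### Algorithms with a step count

A deterministic random access machine, programmed by structured programs. Memory consists of
natural-number variables and two-dimensional arrays of natural numbers. Elementary operations
(reading a variable or an array cell, addition, truncated subtraction, comparison, writing a cell,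
testing, producing output) cost one step each. There is no multiplication, so that numbers have at
most linearly many bits in the running time and polynomial time agrees with that of Turing
machines. -/

/-- Memory and output of the machine. -/
structure State where
  /-- the variables -/
  var : ℕ → ℕ
  /-- the arrays: `arr a i j` is the cell `(i, j)` of the array `a` -/
  arr : ℕ → ℕ → ℕ → ℕ
  /-- the output, a list of lists of numbers (latest first) -/
  out : List (List ℕ)

/-- Expressions. -/
inductive Expr where
  | const (c : ℕ)
  | var (x : ℕ)
  | read (a : ℕ) (i j : Expr)
  | add (e f : Expr)
  | sub (e f : Expr)
  | lt (e f : Expr)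
  | eq (e f : Expr)

/-- The value of an expression; comparisons give `1` or `0`. -/
def Expr.eval (s : State) : Expr → ℕ
  | .const c => c
  | .var x => s.var x
  | .read a i j => s.arr a (i.eval s) (j.eval s)
  | .add e f => e.eval s + f.eval s
  | .sub e f => e.eval s - f.eval s
  | .lt e f => if e.eval s < f.eval s then 1 else 0
  | .eq e f => if e.eval s = f.eval s then 1 else 0

/-- The number of steps needed to evaluate an expression. -/
def Expr.cost : Expr → ℕ
  | .const _ => 1
  | .var _ => 1
  | .read _ i j => i.cost + j.cost + 1
  | .add e f => e.cost + f.cost + 1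
  | .sub e f => e.cost + f.cost + 1
  | .lt e f => e.cost + f.cost + 1
  | .eq e f => e.cost + f.cost + 1

/-- Programs. -/
inductive Prog where
  /-- do nothing -/
  | skip
  /-- `x := e` -/
  | assign (x : ℕ) (e : Expr)
  /-- `a[i, j] := e` -/
  | store (a : ℕ) (i j e : Expr)
  /-- start a new, empty list in the output -/
  | newList
  /-- add the value of `e` to the most recent list in the output -/
  | put (e : Expr)
  | seq (c₁ c₂ : Prog)
  /-- if `e ≠ 0` then `c₁` else `c₂` -/
  | ite (e : Expr) (c₁ c₂ : Prog)
  /-- while `e ≠ 0` do `c` -/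
  | loop (e : Expr) (c : Prog)

/-- Add a number to the most recent list in the output (starting one if there is none). -/
def putOut (x : ℕ) : List (List ℕ) → List (List ℕ)
  | [] => [[x]]
  | l :: ls => (x :: l) :: ls

/-- `Exec c s t s'`: started in state `s`, the program `c` halts after exactly `t` steps, in
state `s'`. -/
inductive Exec : Prog → State → ℕ → State → Prop
  | skip (s : State) : Exec .skip s 1 s
  | assign (x : ℕ) (e : Expr) (s : State) :
      Exec (.assign x e) s (e.cost + 1) { s with var := Function.update s.var x (e.eval s) }
  | store (a : ℕ) (i j e : Expr) (s : State) :
      Exec (.store a i j e) s (i.cost + j.cost + e.cost + 1)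
        { s with arr := fun a' i' j' =>
            if a' = a ∧ i' = i.eval s ∧ j' = j.eval s then e.eval s else s.arr a' i' j' }
  | newList (s : State) : Exec .newList s 1 { s with out := [] :: s.out }
  | put (e : Expr) (s : State) :
      Exec (.put e) s (e.cost + 1) { s with out := putOut (e.eval s) s.out }
  | seq {c₁ c₂ : Prog} {s s₁ s₂ : State} {t₁ t₂ : ℕ} :
      Exec c₁ s t₁ s₁ → Exec c₂ s₁ t₂ s₂ → Exec (.seq c₁ c₂) s (t₁ + t₂) s₂
  | ite_true {e : Expr} {c₁ c₂ : Prog} {s s' : State} {t : ℕ} :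
      e.eval s ≠ 0 → Exec c₁ s t s' → Exec (.ite e c₁ c₂) s (e.cost + 1 + t) s'
  | ite_false {e : Expr} {c₁ c₂ : Prog} {s s' : State} {t : ℕ} :
      e.eval s = 0 → Exec c₂ s t s' → Exec (.ite e c₁ c₂) s (e.cost + 1 + t) s'
  | loop_false {e : Expr} {c : Prog} {s : State} :
      e.eval s = 0 → Exec (.loop e c) s (e.cost + 1) s
  | loop_true {e : Expr} {c : Prog} {s s₁ s₂ : State} {t₁ t₂ : ℕ} :
      e.eval s ≠ 0 → Exec c s t₁ s₁ → Exec (.loop e c) s₁ t₂ s₂ →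
        Exec (.loop e c) s (e.cost + 1 + t₁ + t₂) s₂

/-- The machine is deterministic: final state and number of steps are determined by the program
and the initial state. -/
theorem Exec.deterministic {c : Prog} {s s₁ : State} {t₁ : ℕ} (h₁ : Exec c s t₁ s₁) :
    ∀ {t₂ : ℕ} {s₂ : State}, Exec c s t₂ s₂ → t₁ = t₂ ∧ s₁ = s₂ := by
  induction h₁ with
  | skip | assign | store | newList | put => intro _ _ h; cases h; exact ⟨rfl, rfl⟩
  | seq _ _ ih₁ ih₂ =>
    intro _ _ h
    cases h with
    | seq k₁ k₂ =>
      obtain ⟨rfl, rfl⟩ := ih₁ k₁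
      obtain ⟨rfl, rfl⟩ := ih₂ k₂
      exact ⟨rfl, rfl⟩
  | ite_true he _ ih =>
    intro _ _ h
    cases h with
    | ite_true _ k => obtain ⟨rfl, rfl⟩ := ih k; exact ⟨rfl, rfl⟩
    | ite_false he' _ => exact absurd he' he
  | ite_false he _ ih =>
    intro _ _ h
    cases h with
    | ite_true he' _ => exact absurd he he'
    | ite_false _ k => obtain ⟨rfl, rfl⟩ := ih k; exact ⟨rfl, rfl⟩
  | loop_false he =>
    intro _ _ h
    cases h with
    | loop_false _ => exact ⟨rfl, rfl⟩
    | loop_true he' _ _ => exact absurd he he'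
  | loop_true he _ _ ih₁ ih₂ =>
    intro _ _ h
    cases h with
    | loop_false he' => exact absurd he' he
    | loop_true _ k₁ k₂ =>
      obtain ⟨rfl, rfl⟩ := ih₁ k₁
      obtain ⟨rfl, rfl⟩ := ih₂ k₂
      exact ⟨rfl, rfl⟩

open Classical in
/-- The initial state on input `G`: variable `0` holds the number of vertices, array `0` holds the
adjacency matrix, everything else is `0` and the output is empty. -/
noncomputable def inputState {n : ℕ} (G : SimpleGraph (Fin n)) : State where
  var x := if x = 0 then n else 0
  arr a i j := if a = 0 ∧ ∃ (hi : i < n) (hj : j < n), G.Adj ⟨i, hi⟩ ⟨j, hj⟩ then 1 else 0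
  out := []

/-- The output consists of lists of vertices, and `𝓢` is the collection of the sets listed. -/
def OutputsFamily {n : ℕ} (out : List (List ℕ)) (𝓢 : Set (Set (Fin n))) : Prop :=
  (∀ l ∈ out, ∀ x ∈ l, x < n) ∧ 𝓢 = {X | ∃ l ∈ out, X = {v : Fin n | (v : ℕ) ∈ l}}

/-- On input `G`, the program `c` halts after at most `t` steps and returns the collection `𝓢`. -/
def ReturnsWithin {n : ℕ} (c : Prog) (G : SimpleGraph (Fin n)) (t : ℕ)
    (𝓢 : Set (Set (Fin n))) : Prop :=
  ∃ t' ≤ t, ∃ s, Exec c (inputState G) t' s ∧ OutputsFamily s.out 𝓢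

end SepCarving

/-! The algorithm outputs the set `candidate` for every choice of at most one vertex, five sets of
at most `d + 10` vertices, and two flags. For fixed `d` these are polynomially many choices, and
each set comes from a simple closure procedure. The mathematical content is
`exists_carver_candidate`: some choice yields a carver. The unknown forest enters only through few
vertices: `S ∩ T.verts` lies on a vertical path, so it has at most `d` elements; and in a full
component `A`, all but `d` vertices of the forest lie in one co-component of `G[A]`
(`exists_main_coComp`).

Excluding six-vertex paths is used through two facts. If `v` starts an induced four-vertex path into
one of two anticomplete connected sets and has a neighbour in the other, it is complete to the other
(`PathInto.complete`). Two full components contain six vertices that dominate the separator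
(`exists_dominating`). Both domination and the non-mesh case rest on `exists_pair`, a statement
about modules in a connected graph.

The closure grows a set from a few seeds, adding permitted vertices with a neighbour in the set, a
non-neighbour in it, or both; the permitted region is chosen so that it stops in the right place.
Subordinate: the neighbour rule away from a dominating set of the larger separator recovers a full
component `C`, and `N(C) = S`. Non-mesh: the rule demanding both recovers a full component `A`,
because its result is a module containing two vertices that no proper module contains. Mixed: the
non-neighbour rule recovers the main co-component `K` of the mesh component. Adding the few other
forest vertices of `A` and a vertex of `A` outside `K` gives `X ⊆ A` that dominates `A`; its
neighbourhood carves `A` away and meets the forest only in `S`. Mesh: the same rule may spill into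
`S`, but only to vertices whose neighbours in the forest are harmless; the frame separates the
components other than the two mesh ones. -/

namespace SepCarving

/-! ### Connectivity, modules and domination in graphs without induced six-vertex paths -/

section GraphTheory

variable {V : Type*} {G : SimpleGraph V}

/-- Connectedness of `G[A]`, expressed through cuts (the empty set counts as connected). -/
def CutConn (G : SimpleGraph V) (A : Set V) : Prop :=
  ∀ X : Set V, (∃ a ∈ A, a ∈ X) → (∃ b ∈ A, b ∉ X) → ∃ a ∈ A, a ∈ X ∧ ∃ b ∈ A, b ∉ X ∧ G.Adj a b

theorem cutConn_of_connected {A : Set V} (h : (G.induce A).Connected) : CutConn G A := by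
  rintro X ⟨a, haA, haX⟩ ⟨b, hbA, hbX⟩
  obtain ⟨w⟩ := h.preconnected ⟨a, haA⟩ ⟨b, hbA⟩
  obtain ⟨d, -, h1, h2⟩ := w.exists_boundary_dart {z | z.1 ∈ X} haX hbX
  exact ⟨d.fst.1, d.fst.2, h1, d.snd.1, d.snd.2, h2, d.adj⟩

theorem cutConn_compl_of_connected {A : Set V} (h : (G.induce A)ᶜ.Connected) : CutConn Gᶜ A := by
  apply cutConn_of_connected
  convert h using 1
  ext x y
  simp [SimpleGraph.compl_adj, Subtype.ext_iff]

theorem connected_compl_of_cutConn {A : Set V} (hne : A.Nonempty) (h : CutConn Gᶜ A) :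
    (G.induce A)ᶜ.Connected := by
  obtain ⟨x, hx⟩ := hne
  rw [SimpleGraph.connected_iff_exists_forall_reachable]
  refine ⟨⟨x, hx⟩, ?_⟩
  by_contra! hcon
  obtain ⟨y, hy⟩ := hcon
  obtain ⟨a, haA, ⟨_, hra⟩, b, hbA, hbX, hab⟩ :=
    h {z | ∃ hz : z ∈ A, (G.induce A)ᶜ.Reachable ⟨x, hx⟩ ⟨z, hz⟩}
      ⟨x, hx, hx, SimpleGraph.Reachable.refl _⟩ ⟨y.1, y.2, fun ⟨_, h'⟩ => hy h'⟩
  refine hbX ⟨hbA, hra.trans (SimpleGraph.Adj.reachable ?_)⟩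
  rw [SimpleGraph.compl_adj] at hab ⊢
  exact ⟨fun h => hab.1 (congrArg Subtype.val h), hab.2⟩

theorem IsComp.subset_compl {S D : Set V} (h : IsComp G S D) {v : V} (hv : v ∈ D) : v ∉ S := by
  obtain ⟨c, rfl⟩ := h
  obtain ⟨x, -, rfl⟩ := hv
  exact x.2

theorem IsComp.nonempty {S D : Set V} (h : IsComp G S D) : D.Nonempty := by
  obtain ⟨c, rfl⟩ := h
  exact c.nonempty_supp.image _

theorem IsComp.mem_of_adj {S D : Set V} (h : IsComp G S D) {u v : V} (hu : u ∈ D)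
    (huv : G.Adj u v) (hv : v ∉ S) : v ∈ D := by
  obtain ⟨c, rfl⟩ := h
  obtain ⟨x, hx, rfl⟩ := hu
  refine ⟨⟨v, hv⟩, ?_, rfl⟩
  exact (c.mem_supp_congr_adj (show (G.induce Sᶜ).Adj x ⟨v, hv⟩ from huv)).1 hx

theorem IsComp.cutConn {S D : Set V} (h : IsComp G S D) : CutConn G D := by
  obtain ⟨c, rfl⟩ := h
  rintro X ⟨_, ⟨x, hxc, rfl⟩, haX⟩ ⟨_, ⟨y, hyc, rfl⟩, hbX⟩
  have hr : (G.induce Sᶜ).Reachable x y := by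
    rw [SimpleGraph.ConnectedComponent.mem_supp_iff] at hxc hyc
    exact SimpleGraph.ConnectedComponent.exact (hxc.trans hyc.symm)
  obtain ⟨a, haA, ⟨hac, haX⟩, b, hbX, hab⟩ : ∃ a, a ∈ c.supp ∧ (a ∈ c.supp ∧ a.1 ∈ X) ∧
      ∃ b, ¬ (b ∈ c.supp ∧ b.1 ∈ X) ∧ (G.induce Sᶜ).Adj a b := by
    obtain ⟨w⟩ := hr
    obtain ⟨d, -, h1, h2⟩ := w.exists_boundary_dart {z | z ∈ c.supp ∧ z.1 ∈ X} ⟨hxc, haX⟩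
      (fun h => hbX h.2)
    exact ⟨d.fst, h1.1, h1, d.snd, h2, d.adj⟩
  have hbc : b ∈ c.supp := (c.mem_supp_congr_adj hab).1 haA
  exact ⟨a.1, ⟨a, hac, rfl⟩, haX, b.1, ⟨b, hbc, rfl⟩, fun h => hbX ⟨hbc, h⟩, hab⟩

/-- A connected set that meets a set `X` and contains no outside neighbour of `X` lies in `X`. -/
theorem CutConn.subset_of_closed {C X : Set V} (hC : CutConn G C) (hne : (C ∩ X).Nonempty)
    (h : ∀ a ∈ C, a ∈ X → ∀ b ∈ C, G.Adj a b → b ∈ X) : C ⊆ X := by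
  intro v hv
  by_contra hvX
  obtain ⟨x, hxC, hxX⟩ := hne
  obtain ⟨a, haC, haX, b, hbC, hbX, hab⟩ := hC X ⟨x, hxC, hxX⟩ ⟨v, hv, hvX⟩
  exact hbX (h a haC haX b hbC hab)

theorem IsComp.eq_of_inter {S D D' : Set V} (h : IsComp G S D) (h' : IsComp G S D')
    (hne : (D ∩ D').Nonempty) : D = D' := by
  apply Set.Subset.antisymm
  · exact h.cutConn.subset_of_closed hne fun a _ ha' b hb hab =>
      h'.mem_of_adj ha' hab (h.subset_compl hb)
  · rw [Set.inter_comm] at hne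
    exact h'.cutConn.subset_of_closed hne fun a _ ha' b hb hab =>
      h.mem_of_adj ha' hab (h'.subset_compl hb)

/-- There are no six vertices inducing a path. -/
theorem P6Free.no_path (hG : P6Free G) {a b c d e f : V} (hab : G.Adj a b) (hbc : G.Adj b c)
    (hcd : G.Adj c d) (hde : G.Adj d e) (hef : G.Adj e f) (hac : ¬ G.Adj a c) (had : ¬ G.Adj a d)
    (hae : ¬ G.Adj a e) (haf : ¬ G.Adj a f) (hbd : ¬ G.Adj b d) (hbe : ¬ G.Adj b e)
    (hbf : ¬ G.Adj b f) (hce : ¬ G.Adj c e) (hcf : ¬ G.Adj c f) (hdf : ¬ G.Adj d f) : False := by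
  apply hG
  have key : ∀ i j : Fin 6, G.Adj (![a, b, c, d, e, f] i) (![a, b, c, d, e, f] j) ↔
      (SimpleGraph.pathGraph 6).Adj i j := by
    intro i j
    rw [SimpleGraph.pathGraph_adj]
    fin_cases i <;> fin_cases j <;> simp [*, G.adj_comm]
  refine ⟨⟨⟨![a, b, c, d, e, f], ?_⟩, key _ _⟩⟩
  -- Injectivity is automatic: equal images have equal adjacencies, and distinct vertices of the
  -- six-vertex path have distinct neighbourhoods.
  intro i j hij
  have h : ∀ k, (SimpleGraph.pathGraph 6).Adj i k ↔ (SimpleGraph.pathGraph 6).Adj j k := by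
    intro k
    rw [← key, ← key, hij]
  simp only [SimpleGraph.pathGraph_adj] at h
  clear hij
  revert i j
  decide

/-- There is an induced path on four vertices that starts in `v` and continues in `A`. -/
def PathInto (G : SimpleGraph V) (v : V) (A : Set V) : Prop :=
  ∃ a ∈ A, ∃ b ∈ A, ∃ c ∈ A, G.Adj v a ∧ G.Adj a b ∧ G.Adj b c ∧
    ¬ G.Adj v b ∧ ¬ G.Adj v c ∧ ¬ G.Adj a c

/-- If `v` had a neighbour and a non-neighbour in `A`, then some edge of `A` would have exactly one
end adjacent to `v`; prepended to the path from `v` into `B`, it gives an induced six-vertex path.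
-/
theorem PathInto.complete (hG : P6Free G) {A B : Set V} (hA : CutConn G A)
    (hAB : ∀ a ∈ A, ∀ b ∈ B, ¬ G.Adj a b) {v : V} (hv : ∃ a ∈ A, G.Adj v a)
    (hp : PathInto G v B) : ∀ a ∈ A, G.Adj v a := by
  intro a ha
  by_contra hva
  obtain ⟨a', ha', hva'⟩ := hv
  obtain ⟨x, hx, hxv, y, hy, hyv, hxy⟩ := hA {z | G.Adj v z} ⟨a', ha', hva'⟩ ⟨a, ha, hva⟩
  obtain ⟨b, hb, c, hc, d, hd, h1, h2, h3, h4, h5, h6⟩ := hp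
  exact hG.no_path hxy.symm (SimpleGraph.Adj.symm hxv) h1 h2 h3
    (fun h => hyv (SimpleGraph.Adj.symm h)) (hAB _ hy _ hb) (hAB _ hy _ hc) (hAB _ hy _ hd) (hAB _ hx _ hb) (hAB _ hx _ hc) (hAB _ hx _ hd) h4 h5 h6

/-- Take a minimal set containing `x` that no edge of `G[X]` leaves. A cut of it without crossing
edges would leave a smaller such set on the side of `x`. -/
theorem exists_comp [Finite V] (G : SimpleGraph V) {X : Set V} {x : V} (hx : x ∈ X) :
    ∃ K ⊆ X, x ∈ K ∧ CutConn G K ∧ ∀ a ∈ K, ∀ b ∈ X, b ∉ K → ¬ G.Adj a b := by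
  obtain ⟨K, hK⟩ := (Set.toFinite {K : Set V | K ⊆ X ∧ x ∈ K ∧
    ∀ a ∈ K, ∀ b ∈ X, b ∉ K → ¬ G.Adj a b}).exists_minimal ⟨X, subset_rfl, hx, by tauto⟩
  obtain ⟨⟨hKX, hxK, hcl⟩, hmin⟩ := hK
  refine ⟨K, hKX, hxK, ?_, hcl⟩
  have aux : ∀ Y : Set V, x ∈ Y → (∃ b ∈ K, b ∉ Y) →
      ∃ a ∈ K, a ∈ Y ∧ ∃ b ∈ K, b ∉ Y ∧ G.Adj a b := by
    rintro Y hxY ⟨b, hbK, hbY⟩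
    by_contra! hcon
    have := hmin (y := K ∩ Y) ⟨Set.inter_subset_left.trans hKX, ⟨hxK, hxY⟩, ?_⟩
      Set.inter_subset_left
    · exact hbY (this hbK).2
    · rintro a ⟨haK, haY⟩ c hcX hc
      by_cases hcK : c ∈ K
      · exact hcon a haK haY c hcK (fun h => hc ⟨hcK, h⟩)
      · exact hcl a haK c hcX hcK
  rintro Y ⟨a, haK, haY⟩ ⟨b, hbK, hbY⟩
  by_cases hxY : x ∈ Y
  · exact aux Y hxY ⟨b, hbK, hbY⟩
  · obtain ⟨c, hc, hcY, e, he, heY, hce⟩ := aux Yᶜ hxY ⟨a, haK, by simpa using haY⟩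
    exact ⟨e, he, by simpa using heY, c, hc, hcY, hce.symm⟩

/-- The co-component `K` of `x` in `G[X]`. -/
theorem exists_coComp [Finite V] (G : SimpleGraph V) {X : Set V} {x : V} (hx : x ∈ X) :
    ∃ K ⊆ X, x ∈ K ∧ CutConn Gᶜ K ∧ ∀ a ∈ K, ∀ b ∈ X, b ∉ K → G.Adj a b := by
  obtain ⟨K, h1, h2, h3, h4⟩ := exists_comp Gᶜ hx
  refine ⟨K, h1, h2, h3, fun a ha b hb hbK => ?_⟩
  by_contra hab
  exact h4 a ha b hb hbK ((SimpleGraph.compl_adj _ _ _).2 ⟨fun h => hbK (h ▸ ha), hab⟩)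

/-- In a connected set, two vertices that lie in no common proper module, provided that the set is
also connected in the complement. -/
theorem exists_module_pair [Finite V] {A : Set V} (hne : A.Nonempty) (hA : CutConn G A)
    (hco : CutConn Gᶜ A) : ∃ p ∈ A, ∃ q ∈ A, (p = q ∨ G.Adj p q) ∧
      ∀ M ⊆ A, p ∈ M → q ∈ M →
        (∀ u ∈ A, u ∉ M → ∀ a ∈ M, ∀ b ∈ M, G.Adj u a → G.Adj u b) → M = A := by
  obtain ⟨x, hx⟩ := hne
  by_cases hsub : A ⊆ {x}
  · refine ⟨x, hx, x, hx, Or.inl rfl, fun M hM hxM _ _ => hM.antisymm fun z hz => ?_⟩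
    rw [hsub hz]; exact hxM
  let F : Set (Set V) := {M | M ⊆ A ∧ M ≠ A ∧ M.Nonempty ∧
    ∀ u ∈ A, u ∉ M → ∀ a ∈ M, ∀ b ∈ M, G.Adj u a → G.Adj u b}
  -- The pair is an edge leaving a maximal proper module `M`.
  obtain ⟨M, hM⟩ := (Set.toFinite F).exists_maximal ⟨{x}, by simpa using hx,
    fun h => hsub h.ge, ⟨x, rfl⟩, by rintro u _ _ a rfl b rfl; exact id⟩
  obtain ⟨⟨hMA, hMne, ⟨m, hm⟩, hmod⟩, hmax⟩ := hM
  obtain ⟨z, hzA, hzM⟩ : ∃ z ∈ A, z ∉ M := by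
    by_contra! h
    exact hMne (hMA.antisymm h)
  obtain ⟨p, hpA, hpM, q, hqA, hqM, hpq⟩ := hA M ⟨m, hMA hm, hm⟩ ⟨z, hzA, hzM⟩
  refine ⟨p, hpA, q, hqA, Or.inr hpq, fun M' hM' hpM' hqM' hmod' => ?_⟩
  by_contra hne'
  -- Both modules contain `p`, so their union is again a module; it contains `q ∉ M`, so maximality
  -- makes it all of `A`.
  have hun : M ∪ M' = A := by
    by_contra hun
    refine hqM (hmax (y := M ∪ M') ⟨Set.union_subset hMA hM', hun, ⟨p, Or.inl hpM⟩, ?_⟩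
      Set.subset_union_left (Or.inr hqM'))
    intro u hu huM a ha b hb hua
    have h1 : G.Adj u p := by
      rcases ha with ha | ha
      · exact hmod u hu (fun h => huM (Or.inl h)) a ha p hpM hua
      · exact hmod' u hu (fun h => huM (Or.inr h)) a ha p hpM' hua
    rcases hb with hb | hb
    · exact hmod u hu (fun h => huM (Or.inl h)) p hpM b hb h1
    · exact hmod' u hu (fun h => huM (Or.inr h)) p hpM' b hb h1
  obtain ⟨w, hwA, hwM'⟩ : ∃ z ∈ A, z ∉ M' := by
    by_contra! h
    exact hne' (hM'.antisymm h)
  have hmem : ∀ z ∈ A, z ∉ M' → z ∈ M := fun z hz hz' => by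
    rw [← hun] at hz; exact hz.resolve_right hz'
  -- Now `A \ M' ⊆ M`. One edge between `M'` and its complement forces every pair across to be
  -- adjacent: from `a` to `q` by `M'`, from `q` to `a'` by `M`, from `a'` to `b'` by `M'`. This
  -- contradicts connectedness of the complement.
  obtain ⟨b, hbA, hbM', a, haA, haM', hba⟩ := hA M' ⟨q, hqA, hqM'⟩ ⟨w, hwA, hwM'⟩
  obtain ⟨b', hbA', hbM'', a', haA', haM'', hba'⟩ := hco M' ⟨q, hqA, hqM'⟩ ⟨w, hwA, hwM'⟩
  have h1 : G.Adj a q := hmod' a haA haM' b hbM' q hqM' hba.symm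
  have h2 : G.Adj q a' := hmod q hqA hqM a (hmem a haA haM') a' (hmem a' haA' haM'') h1.symm
  have h3 : G.Adj a' b' := hmod' a' haA' haM'' q hqM' b' hbM'' h2.symm
  exact ((SimpleGraph.compl_adj _ _ _).1 hba').2 h3.symm

/-- Two vertices of a connected set `A` that see every vertex of `N(A)` except those with an
induced path into `A` and those whose neighbours in `A` are joined to the other vertices. -/
theorem exists_pair [Finite V] {A : Set V} (hne : A.Nonempty) (hA : CutConn G A) :
    ∃ p ∈ A, ∃ q ∈ A, ∀ v ∉ A, (∃ a ∈ A, G.Adj v a) →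
      G.Adj v p ∨ G.Adj v q ∨ PathInto G v A ∨
        ∀ a ∈ A, ∀ b ∈ A, G.Adj v a → ¬ G.Adj v b → G.Adj a b := by
  -- `K` is the component of `p` among the non-neighbours of `v` in `A`. A vertex outside `K` with a
  -- neighbour in `K` is adjacent to `v`; if it distinguished two vertices of `K`, it would
  -- distinguish the ends of an edge of `K`, giving an induced path from `v` into `A`.
  have key : ∀ p ∈ A, ∀ q ∈ A, (p = q ∨ G.Adj p q) → ∀ v ∉ A, ¬ G.Adj v p → ¬ G.Adj v q →
      ¬ PathInto G v A → ∃ K ⊆ A, p ∈ K ∧ q ∈ K ∧ (∀ a ∈ K, ¬ G.Adj v a) ∧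
        (∀ u ∈ A, u ∉ K → ∀ a ∈ K, ∀ b ∈ K, G.Adj u a → G.Adj u b) ∧
        (∀ u ∈ A, u ∉ K → ¬ G.Adj v u → ∀ a ∈ K, ¬ G.Adj u a) := by
    intro p hp q hq hpq v _ hvp hvq hP
    obtain ⟨K, hK, hpK, hconn, hcl⟩ := exists_comp G (X := {a | a ∈ A ∧ ¬ G.Adj v a}) ⟨hp, hvp⟩
    refine ⟨K, fun a ha => (hK ha).1, hpK, ?_, fun a ha => (hK ha).2, ?_, ?_⟩
    · rcases hpq with rfl | hpq
      · exact hpK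
      · by_contra hqK
        exact hcl p hpK q ⟨hq, hvq⟩ hqK hpq
    · intro u hu huK a ha b hb hua
      by_contra hub
      by_cases hvu : G.Adj v u
      · obtain ⟨c, hc, huc, e, he, hue, hce⟩ := hconn {z | G.Adj u z} ⟨a, ha, hua⟩ ⟨b, hb, hub⟩
        exact hP ⟨u, hu, c, (hK hc).1, e, (hK he).1, hvu, huc, hce, (hK hc).2, (hK he).2, hue⟩
      · exact hcl a ha u ⟨hu, hvu⟩ huK hua.symm
    · intro u hu huK hvu a ha hua
      exact hcl a ha u ⟨hu, hvu⟩ huK hua.symm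
  by_cases hco : CutConn Gᶜ A
  · obtain ⟨p, hp, q, hq, hpq, hM⟩ := exists_module_pair hne hA hco
    refine ⟨p, hp, q, hq, fun v hv hva => ?_⟩
    by_contra! hcon
    obtain ⟨hvp, hvq, hP, -⟩ := hcon
    obtain ⟨K, hK, hpK, hqK, hvK, hmod, -⟩ := key p hp q hq hpq v hv hvp hvq hP
    obtain ⟨a, ha, hva⟩ := hva
    exact hvK a ((hM K hK hpK hqK hmod) ▸ ha) hva
  · obtain ⟨p, hp⟩ := hne
    obtain ⟨A₁, hA₁, hpA₁, hco₁, hcpl⟩ := exists_coComp G hp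
    obtain ⟨q, hq, hqA₁⟩ : ∃ q ∈ A, q ∉ A₁ := by
      by_contra! h
      exact hco (hA₁.antisymm h ▸ hco₁)
    refine ⟨p, hp, q, hq, fun v hv _ => ?_⟩
    by_contra! hcon
    obtain ⟨hvp, hvq, hP, a, ha, b, hb, hva, hvb, hab⟩ := hcon
    obtain ⟨K, hK, hpK, hqK, hvK, hmod, hanti⟩ :=
      key p hp q hq (Or.inr (hcpl p hpA₁ q hq hqA₁)) v hv hvp hvq hP
    -- The module `K` meets two co-components, so it is complete to the rest of `A`. Hence `K` is
    -- the whole set of non-neighbours of `v` in `A`.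
    have hcompl : ∀ u ∈ A, u ∉ K → ∀ a ∈ K, G.Adj u a := by
      intro u hu huK a ha
      by_cases huA₁ : u ∈ A₁
      · exact hmod u hu huK q hqK a ha (hcpl u huA₁ q hq hqA₁)
      · exact hmod u hu huK p hpK a ha (hcpl p hpA₁ u hu huA₁).symm
    by_cases hbK : b ∈ K
    · exact hab (hcompl a ha (fun h => hvK a h hva) b hbK)
    · exact hanti b hb hbK hvb p hpK (hcompl b hb hbK p hpK)

/-- Every set of common neighbours of two connected anticomplete sets `A`, `B` is dominated by six
vertices of `A ∪ B`. -/
theorem exists_dominating [Finite V] (hG : P6Free G) {A B S : Set V} (hAne : A.Nonempty)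
    (hBne : B.Nonempty) (hA : CutConn G A) (hB : CutConn G B)
    (hAB : ∀ a ∈ A, ∀ b ∈ B, ¬ G.Adj a b) (hSA : ∀ v ∈ S, v ∉ A) (hSB : ∀ v ∈ S, v ∉ B)
    (hNA : ∀ v ∈ S, ∃ a ∈ A, G.Adj v a) (hNB : ∀ v ∈ S, ∃ b ∈ B, G.Adj v b) :
    ∃ Q ⊆ A ∪ B, Q.ncard ≤ 6 ∧ ∀ v ∈ S, ∃ q ∈ Q, G.Adj v q := by
  have hBA : ∀ b ∈ B, ∀ a ∈ A, ¬ G.Adj b a := fun b hb a ha h => hAB a ha b hb h.symm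
  obtain ⟨p, hp, q, hq, hpq⟩ := exists_pair hAne hA
  obtain ⟨p', hp', q', hq', hpq'⟩ := exists_pair hBne hB
  -- For the vertices not dominated by the two pairs, an induced path into one side would force
  -- completeness to the other side. Hence their neighbours on each side are complete to their
  -- non-neighbours there.
  let X : Set V := {v | v ∈ S ∧ ¬ G.Adj v p ∧ ¬ G.Adj v q ∧ ¬ G.Adj v p' ∧ ¬ G.Adj v q'}
  have hXA : ∀ v ∈ X, ∀ a ∈ A, ∀ b ∈ A, G.Adj v a → ¬ G.Adj v b → G.Adj a b := by
    rintro v ⟨hv, h1, h2, h3, h4⟩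
    rcases hpq v (hSA v hv) (hNA v hv) with h | h | h | h
    · exact absurd h h1
    · exact absurd h h2
    · exact absurd (h.complete hG hB hBA (hNB v hv) p' hp') h3
    · exact h
  have hXB : ∀ v ∈ X, ∀ a ∈ B, ∀ b ∈ B, G.Adj v a → ¬ G.Adj v b → G.Adj a b := by
    rintro v ⟨hv, h1, h2, h3, h4⟩
    rcases hpq' v (hSB v hv) (hNB v hv) with h | h | h | h
    · exact absurd h h3
    · exact absurd h h4
    · exact absurd (h.complete hG hA hAB (hNA v hv) p hp) h1
    · exact h
  obtain ⟨a, ha, b, hb, hab⟩ : ∃ a ∈ A, ∃ b ∈ B, ∀ w ∈ X, G.Adj w a ∨ G.Adj w b := by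
    rcases X.eq_empty_or_nonempty with hX | hX
    · exact ⟨p, hp, p', hp', by simp [hX]⟩
    obtain ⟨v, hvX, hmin⟩ := X.toFinite.exists_minimalFor
      (fun v => {a | a ∈ A ∧ G.Adj v a}.ncard) X hX
    obtain ⟨a, ha, hva⟩ := hNA v hvX.1
    obtain ⟨b, hb, hvb⟩ := hNB v hvX.1
    refine ⟨a, ha, b, hb, fun w hw => ?_⟩
    by_contra! hcon
    obtain ⟨hwa, hwb⟩ := hcon
    obtain ⟨c, hc, hwc, hvc⟩ : ∃ c ∈ A, G.Adj w c ∧ ¬ G.Adj v c := by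
      by_contra! h
      have hss : {a | a ∈ A ∧ G.Adj w a} ⊂ {a | a ∈ A ∧ G.Adj v a} :=
        ⟨fun z hz => ⟨hz.1, h z hz.1 hz.2⟩, fun h' => hwa (h' ⟨ha, hva⟩).2⟩
      have hlt := Set.ncard_lt_ncard hss (Set.toFinite _)
      exact absurd (hmin hw hlt.le) (not_le.2 hlt)
    have hpv := hvX.2.1
    have hpw := hw.2.1
    have hpv' := hvX.2.2.2.1
    have hpw' := hw.2.2.2.1
    -- Here `v` has fewest neighbours in `A`, so a vertex `w` missing `a` has a private neighbour
    -- `c`. The induced path is `p c w v b p'` if `v` and `w` are adjacent, and `p' b v a c w`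
    -- otherwise.
    by_cases hvw : G.Adj v w
    · exact hG.no_path (hXA w hw c hc p hp hwc hpw).symm hwc.symm hvw.symm hvb
        (hXB v hvX b hb p' hp' hvb hpv') (fun h => hpw h.symm) (fun h => hpv h.symm)
        (hAB _ hp _ hb) (hAB _ hp _ hp') (fun h => hvc h.symm) (hAB _ hc _ hb) (hAB _ hc _ hp')
        hwb hpw' hpv'
    · exact hG.no_path (hXB v hvX b hb p' hp' hvb hpv').symm hvb.symm hva
        (hXA v hvX a ha c hc hva hvc) hwc.symm (fun h => hpv' h.symm) (hBA _ hp' _ ha)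
        (hBA _ hp' _ hc) (fun h => hpw' h.symm) (hBA _ hb _ ha) (hBA _ hb _ hc)
        (fun h => hwb h.symm) hvc hvw (fun h => hwa h.symm)
  refine ⟨{p, q, p', q', a, b}, ?_, ?_, ?_⟩
  · rintro z (rfl | rfl | rfl | rfl | rfl | rfl) <;> simp [*]
  · refine (Set.ncard_insert_le _ _).trans (Nat.succ_le_succ ?_)
    refine (Set.ncard_insert_le _ _).trans (Nat.succ_le_succ ?_)
    refine (Set.ncard_insert_le _ _).trans (Nat.succ_le_succ ?_)
    refine (Set.ncard_insert_le _ _).trans (Nat.succ_le_succ ?_)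
    refine (Set.ncard_insert_le _ _).trans (Nat.succ_le_succ ?_)
    exact (Set.ncard_singleton _).le
  · intro v hv
    by_contra! hcon
    have hvX : v ∈ X := ⟨hv, hcon p (by simp), hcon q (by simp), hcon p' (by simp),
      hcon q' (by simp)⟩
    rcases hab v hvX with h | h
    · exact hcon a (by simp) h
    · exact hcon b (by simp) h

end GraphTheory

/-! ### Chains in treedepth structures -/

namespace RootedForest

variable {V : Type*} {T : RootedForest V}

theorem IsAncestor.trans {u v w : V} (h : T.IsAncestor u v) (h' : T.IsAncestor v w) :
    T.IsAncestor u w :=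
  ⟨h'.1, h'.2.trans h.2⟩

theorem comparable_of_isAncestor {u v w : V} (hu : u ∈ T.verts) (hv : v ∈ T.verts)
    (huw : T.IsAncestor u w) (hvw : T.IsAncestor v w) : T.Comparable u v := by
  have hr : Relator.RightUnique fun x y => T.parent x = some y := fun a b c h h' =>
    Option.some.inj (Eq.trans (Eq.symm h) h')
  rcases Relation.ReflTransGen.total_of_right_unique hr huw.2 hvw.2 with h | h
  · exact Or.inr ⟨hu, h⟩
  · exact Or.inl ⟨hv, h⟩

theorem ncard_le_of_subset_ancestors [Finite V] {G : SimpleGraph V} {d : ℕ}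
    (hT : T.IsTDStructure G d) {X : Set V} {w : V} (hw : w ∈ T.verts)
    (hX : ∀ x ∈ X, T.IsAncestor x w) : X.ncard ≤ d :=
  (Set.ncard_le_ncard hX (Set.toFinite _)).trans (hT.1 w hw)

theorem ncard_le_of_inVerticalPath [Finite V] {G : SimpleGraph V} {d : ℕ}
    (hT : T.IsTDStructure G d) {X : Set V} (hX : T.InVerticalPath X) : X.ncard ≤ d := by
  rcases hX with rfl | ⟨u, w, huw, hX⟩
  · simp
  · exact ncard_le_of_subset_ancestors hT huw.1 fun x hx => (hX hx).2

/-- All elements of the chain are ancestors of one of maximal depth. -/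
theorem ncard_le_of_chain [Finite V] {G : SimpleGraph V} {d : ℕ}
    (hT : T.IsTDStructure G d) {X : Set V} (hXT : X ⊆ T.verts)
    (hX : ∀ x ∈ X, ∀ y ∈ X, T.Comparable x y) : X.ncard ≤ d := by
  rcases X.eq_empty_or_nonempty with rfl | hne
  · simp
  obtain ⟨w, hw, hmax⟩ := X.toFinite.exists_maximalFor (fun v => T.depth v) X hne
  refine ncard_le_of_subset_ancestors hT (hXT hw) fun x hx => ?_
  rcases hX x hx w hw with h | h
  · exact h
  · have hsub : {u | T.IsAncestor u w} ⊆ {u | T.IsAncestor u x} := fun u hu => hu.trans h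
    have hle : T.depth x ≤ T.depth w := hmax hx (Set.ncard_le_ncard hsub (Set.toFinite _))
    have := Set.eq_of_subset_of_ncard_le hsub hle (Set.toFinite _)
    exact this.ge (show T.IsAncestor x x from ⟨hXT hx, .refl⟩)

/-- All but boundedly many vertices of a treedepth structure inside `A` lie in a single
co-component of `G[A]`. -/
theorem exists_main_coComp [Finite V] {G : SimpleGraph V} {d : ℕ} (hT : T.IsTDStructure G d)
    {A : Set V} (hne : A.Nonempty) : ∃ K ⊆ A, K.Nonempty ∧ CutConn Gᶜ K ∧
      (∀ a ∈ K, ∀ b ∈ A, b ∉ K → G.Adj a b) ∧ {v | v ∈ A ∧ v ∉ K ∧ v ∈ T.verts}.ncard ≤ d := by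
  by_cases hch : ∀ x ∈ A ∩ T.verts, ∀ y ∈ A ∩ T.verts, T.Comparable x y
  · obtain ⟨x, hx⟩ := hne
    obtain ⟨K, h1, h2, h3, h4⟩ := exists_coComp G hx
    refine ⟨K, h1, ⟨x, h2⟩, h3, h4, ?_⟩
    exact (Set.ncard_le_ncard (t := A ∩ T.verts) (fun v hv => ⟨hv.1, hv.2.2⟩)
      (Set.toFinite _)).trans (ncard_le_of_chain hT Set.inter_subset_right hch)
  · push Not at hch
    -- Incomparable `t` and `t'` are non-adjacent, hence in the same co-component `K`. A forest
    -- vertex of `A \ K` is adjacent to both, so comparable with both; this forces it to be an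
    -- ancestor of `t`.
    obtain ⟨t, ⟨htA, htT⟩, t', ⟨htA', htT'⟩, hinc⟩ := hch
    obtain ⟨K, h1, h2, h3, h4⟩ := exists_coComp G htA
    refine ⟨K, h1, ⟨t, h2⟩, h3, h4, ?_⟩
    have ht' : t' ∈ K := by
      by_contra h
      exact hinc (hT.2 t htT t' htT' (h4 t h2 t' htA' h))
    refine ncard_le_of_subset_ancestors hT htT fun z ⟨hzA, hzK, hzT⟩ => ?_
    rcases hT.2 t htT z hzT (h4 t h2 z hzA hzK) with h | h
    · rcases hT.2 t' htT' z hzT (h4 t' ht' z hzA hzK) with h' | h'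
      · exact absurd (comparable_of_isAncestor htT htT' h h') hinc
      · exact absurd (Or.inl (h.trans h')) hinc
    · exact h

end RootedForest

/-! ### The closure procedure and the candidate sets -/

section Candidates

variable {V : Type*} (G : SimpleGraph V)

/-- One round of the closure procedure: add the vertices of `R` that have a neighbour in `X`
(unless `b₁`) and a non-neighbour in `X` (unless `b₂`). -/
def closureStep (R : Set V) (b₁ b₂ : Prop) (X : Set V) : Set V :=
  {v | v ∈ X ∨ v ∈ R ∧ (b₁ ∨ ∃ u ∈ X, G.Adj v u) ∧ (b₂ ∨ ∃ u ∈ X, ¬ G.Adj v u)}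

/-- The least superset of `X` that is closed under `closureStep`. -/
def closureIn (R : Set V) (b₁ b₂ : Prop) (X : Set V) : Set V :=
  (closureStep G R b₁ b₂)^[Nat.card V] X

/-- The vertices neither in `Z` nor adjacent to a vertex of `Z`. -/
def farFrom (Z : Set V) : Set V := {v | v ∉ Z ∧ ∀ z ∈ Z, ¬ G.Adj v z}

/-- The part of a candidate separator that is removed first. -/
def frame (Q U : Set V) : Set V := nbhd G (farFrom G Q) ∪ U

/-- The vertices that the closure procedure may add. -/
def region (Y Z Q U : Set V) : Set V :=
  {v | (∀ y ∈ Y, G.Adj v y) ∧ v ∈ farFrom G Z ∧ v ∉ frame G Q U}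

/-- The candidate separator determined by the guesses `Y`, `Z`, `Q`, `W`, `U`, `X` and by the kind
of closure procedure. -/
def candidate (Y Z Q W U X : Set V) (b₁ b₂ : Prop) : Set V :=
  nbhd G (closureIn G (region G Y Z Q U) b₁ b₂ X ∪ W) ∪ frame G Q U

variable {G}

theorem closureIn_subset {R : Set V} {b₁ b₂ : Prop} {X M : Set V} (hX : X ⊆ M)
    (hM : ∀ v ∈ R, (b₁ ∨ ∃ u ∈ M, G.Adj v u) → (b₂ ∨ ∃ u ∈ M, ¬ G.Adj v u) → v ∈ M) :
    closureIn G R b₁ b₂ X ⊆ M := by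
  unfold closureIn
  induction Nat.card V with
  | zero => exact hX
  | succ k ih =>
    rw [Function.iterate_succ_apply']
    rintro v (hv | ⟨hv, h1, h2⟩)
    · exact ih hv
    · exact hM v hv (h1.imp id fun ⟨u, hu, h⟩ => ⟨u, ih hu, h⟩)
        (h2.imp id fun ⟨u, hu, h⟩ => ⟨u, ih hu, h⟩)

/-- Every round before stabilisation adds a vertex, so as many rounds as there are vertices suffice.
-/
theorem iterate_card_fixed [Finite V] {f : Set V → Set V} (hf : ∀ X, X ⊆ f X) (X : Set V) :
    f (f^[Nat.card V] X) = f^[Nat.card V] X := by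
  have key : ∀ k, f (f^[k] X) = f^[k] X ∨ k + 1 ≤ (f^[k + 1] X).ncard := by
    have hlt : ∀ k, f (f^[k] X) ≠ f^[k] X → (f^[k] X).ncard < (f^[k + 1] X).ncard := by
      intro k hk
      rw [Function.iterate_succ_apply']
      exact Set.ncard_lt_ncard ((hf _).ssubset_of_ne hk.symm) (Set.toFinite _)
    intro k
    induction k with
    | zero =>
      by_cases h : f (f^[0] X) = f^[0] X
      · exact Or.inl h
      · exact Or.inr (Nat.succ_le_of_lt ((Nat.zero_le _).trans_lt (hlt 0 h)))
    | succ k ih =>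
      by_cases h : f (f^[k + 1] X) = f^[k + 1] X
      · exact Or.inl h
      · rcases ih with ih | ih
        · rw [Function.iterate_succ_apply', ih, ih] at h
          exact absurd rfl h
        · exact Or.inr (Nat.succ_le_of_lt (ih.trans_lt (hlt (k + 1) h)))
  refine (key _).resolve_right fun h => ?_
  have := Set.ncard_le_card (f^[Nat.card V + 1] X)
  omega

theorem subset_closureIn {R : Set V} {b₁ b₂ : Prop} {X : Set V} :
    X ⊆ closureIn G R b₁ b₂ X := by
  unfold closureIn
  induction Nat.card V with
  | zero => exact subset_rfl
  | succ k ih =>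
    rw [Function.iterate_succ_apply']
    exact fun v hv => Or.inl (ih hv)

theorem mem_closureIn [Finite V] {R : Set V} {b₁ b₂ : Prop} {X : Set V} {v : V} (hv : v ∈ R)
    (h₁ : b₁ ∨ ∃ u ∈ closureIn G R b₁ b₂ X, G.Adj v u)
    (h₂ : b₂ ∨ ∃ u ∈ closureIn G R b₁ b₂ X, ¬ G.Adj v u) : v ∈ closureIn G R b₁ b₂ X := by
  have h := iterate_card_fixed (f := closureStep G R b₁ b₂) (fun X v hv => Or.inl hv) X
  unfold closureIn at h₁ h₂ ⊢
  rw [← h]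
  exact Or.inr ⟨hv, h₁, h₂⟩

theorem frame_empty : frame G ∅ ∅ = ∅ := by
  ext v
  simp [frame, nbhd, farFrom]

theorem mem_region_of_empty {Z : Set V} {v : V} : v ∈ region G ∅ Z ∅ ∅ ↔ v ∈ farFrom G Z := by
  simp [region, frame_empty]

theorem candidate_of_closure_eq {Z X D : Set V} {b₁ b₂ : Prop}
    (h : closureIn G (region G ∅ Z ∅ ∅) b₁ b₂ X = D) :
    candidate G ∅ Z ∅ ∅ ∅ X b₁ b₂ = nbhd G D := by
  simp [candidate, h, frame_empty]

/-- A closure under the non-neighbour rule swallows every co-connected subset of `R` it meets. -/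
theorem subset_closureIn_of_cutConn_compl [Finite V] {R K X : Set V} (hK : CutConn Gᶜ K)
    (hKR : K ⊆ R) {x : V} (hxK : x ∈ K) (hxX : x ∈ X) : K ⊆ closureIn G R True False X := by
  refine hK.subset_of_closed ⟨x, hxK, subset_closureIn hxX⟩ fun a _ ha b hb hab => ?_
  rw [SimpleGraph.compl_adj] at hab
  exact mem_closureIn (hKR hb) (Or.inl trivial) (Or.inr ⟨a, ha, fun h => hab.2 h.symm⟩)

/-! ### Full components, and a good candidate for each kind of separator -/

theorem IsFullComp.exists_adj {S A : Set V} (h : IsFullComp G S A) {v : V} (hv : v ∈ S) :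
    ∃ a ∈ A, G.Adj v a := by
  rw [← h.2] at hv; exact hv.2

theorem IsFullComp.mem_of_adj {S A : Set V} (h : IsFullComp G S A) {u v : V} (hu : u ∈ A)
    (huv : G.Adj u v) : v ∈ A ∨ v ∈ S := by
  by_cases hv : v ∈ A
  · exact Or.inl hv
  · right; rw [← h.2]; exact ⟨hv, u, hu, huv.symm⟩

theorem IsFullComp.not_adj {S A B : Set V} (hA : IsFullComp G S A) (hB : IsFullComp G S B)
    (hAB : A ≠ B) {a b : V} (ha : a ∈ A) (hb : b ∈ B) : ¬ G.Adj a b := by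
  intro hab
  have hb' : b ∈ A := hA.1.mem_of_adj ha hab (hB.1.subset_compl hb)
  exact hAB (hA.1.eq_of_inter hB.1 ⟨b, hb', hb⟩)

theorem IsFullComp.disjoint {S A B : Set V} (hA : IsFullComp G S A) (hB : IsFullComp G S B)
    (hAB : A ≠ B) {a : V} (ha : a ∈ A) : a ∉ B :=
  fun hb => hAB (hA.1.eq_of_inter hB.1 ⟨a, ha, hb⟩)

theorem IsFullComp.exists_dominating [Finite V] (hG : P6Free G) {S A B : Set V}
    (hA : IsFullComp G S A) (hB : IsFullComp G S B) (hAB : A ≠ B) :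
    ∃ Q ⊆ A ∪ B, Q.ncard ≤ 6 ∧ ∀ v ∈ S, ∃ q ∈ Q, G.Adj v q :=
  SepCarving.exists_dominating hG hA.1.nonempty hB.1.nonempty hA.1.cutConn hB.1.cutConn
    (fun _ ha _ hb => hA.not_adj hB hAB ha hb) (fun _ hv ha => hA.1.subset_compl ha hv)
    (fun _ hv hb => hB.1.subset_compl hb hv) (fun _ hv => hA.exists_adj hv)
    (fun _ hv => hB.exists_adj hv)

/-- Two vertices of a non-mesh full component `B` such that the vertices of the separator that
they do not see are complete to every other full component. -/
theorem exists_pair_of_nonmesh [Finite V] (hG : P6Free G) {S A B : Set V}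
    (hA : IsFullComp G S A) (hB : IsFullComp G S B) (hAB : A ≠ B) (hmB : ¬ IsMeshSet G B) :
    ∃ p ∈ B, ∃ q ∈ B, ∀ v ∈ S, v ∈ farFrom G {p, q} → ∀ a ∈ A, G.Adj v a := by
  obtain ⟨p, hp, q, hq, hpq⟩ := exists_pair hB.1.nonempty hB.1.cutConn
  refine ⟨p, hp, q, hq, fun v hv hfar => ?_⟩
  have hco : CutConn Gᶜ B := cutConn_compl_of_connected (not_not.1 hmB)
  obtain ⟨b, hb, hvb⟩ := hB.exists_adj hv
  rcases hpq v (fun h => hB.1.subset_compl h hv) ⟨b, hb, hvb⟩ with h | h | h | h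
  · exact absurd h (hfar.2 p (by simp))
  · exact absurd h (hfar.2 q (by simp))
  · exact h.complete hG hA.1.cutConn (fun _ ha _ hb => hA.not_adj hB hAB ha hb) (hA.exists_adj hv)
  · obtain ⟨x, hx, hvx, y, hy, hvy, hxy⟩ := hco {z | G.Adj v z} ⟨b, hb, hvb⟩
      ⟨p, hp, hfar.2 p (by simp)⟩
    exact absurd (h x hx y hy hvx hvy) ((SimpleGraph.compl_adj _ _ _).1 hxy).2

theorem IsFullComp.mem_farFrom {S A B Z : Set V} (hA : IsFullComp G S A) (hB : IsFullComp G S B)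
    (hAB : A ≠ B) (hZ : Z ⊆ B) {a : V} (ha : a ∈ A) : a ∈ farFrom G Z :=
  ⟨fun h => hA.disjoint hB hAB ha (hZ h), fun _ hz => hA.not_adj hB hAB ha (hZ hz)⟩

/-- The pair `p', q'` in `B` keeps the closure inside `A`: permitted vertices of `S` are complete to
`A` and so never have the required non-neighbour. The closure is a module of `G[A]` containing the
pair `p, q`, hence is `A`. -/
theorem exists_candidate_of_nonmesh [Finite V] (hG : P6Free G) {S A B : Set V}
    (hA : IsFullComp G S A) (hB : IsFullComp G S B) (hAB : A ≠ B) (hmA : ¬ IsMeshSet G A)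
    (hmB : ¬ IsMeshSet G B) : ∃ p q p' q' : V,
      candidate G ∅ {p', q'} ∅ ∅ ∅ {p, q} False False = S := by
  obtain ⟨p, hp, q, hq, -, hM⟩ := exists_module_pair hA.1.nonempty hA.1.cutConn
    (cutConn_compl_of_connected (not_not.1 hmA))
  obtain ⟨p', hp', q', hq', hcpl⟩ := exists_pair_of_nonmesh hG hA hB hAB hmB
  have hZ : {p', q'} ⊆ B := by rintro _ (rfl | rfl) <;> assumption
  refine ⟨p, q, p', q', (candidate_of_closure_eq (D := A) ?_).trans hA.2⟩
  have hpq : {p, q} ⊆ A := by rintro _ (rfl | rfl) <;> assumption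
  refine hM _ (closureIn_subset hpq ?_) (subset_closureIn (by simp)) (subset_closureIn (by simp)) ?_
  · rintro v hv (h | ⟨u, hu, hvu⟩) (h' | ⟨w, hw, hvw⟩)
    · exact h.elim
    · exact h.elim
    · exact h'.elim
    · refine (hA.mem_of_adj hu hvu.symm).resolve_right fun hvS => ?_
      exact hvw (hcpl v hvS (mem_region_of_empty.1 hv) w hw)
  · intro u hu huX a ha b hb hua
    by_contra hub
    refine huX (mem_closureIn (mem_region_of_empty.2 ?_) (Or.inr ⟨a, ha, hua⟩)
      (Or.inr ⟨b, hb, hub⟩))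
    exact hA.mem_farFrom hB hAB hZ hu

/-- The guessed set dominates `S' ⊇ S` from within `A' ∪ B'`, so avoiding its neighbours excludes
all of `S`, while no vertex of `C` is excluded. -/
theorem exists_candidate_of_subordinate [Finite V] (hG : P6Free G) {S : Set V}
    (hS : IsSubordinate G S) : ∃ (Z : Set V) (c : V), Z.ncard ≤ 6 ∧
      candidate G ∅ Z ∅ ∅ ∅ {c} False True = S := by
  obtain ⟨-, S', A, B, C, -, hAB, hA, hB, hSS', hC, hdisj⟩ := hS
  obtain ⟨Q, hQ, hcard, hdom⟩ := hA.exists_dominating hG hB hAB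
  obtain ⟨c, hc⟩ := hC.1.nonempty
  have hfar : ∀ v ∈ C, v ∈ farFrom G Q := by
    intro v hv
    have hv' : v ∉ A ∪ S' ∪ B := Set.disjoint_left.1 hdisj hv
    refine ⟨fun h => ?_, fun z hz h => ?_⟩
    · rcases hQ h with h | h <;> simp [h] at hv'
    · rcases hQ hz with hz | hz
      · rcases hA.mem_of_adj hz h.symm with h | h <;> simp [h] at hv'
      · rcases hB.mem_of_adj hz h.symm with h | h <;> simp [h] at hv'
  refine ⟨Q, c, hcard, (candidate_of_closure_eq (D := C) ?_).trans hC.2⟩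
  apply Set.Subset.antisymm
  · refine closureIn_subset (by simpa using hc) ?_
    rintro v hv (h | ⟨u, hu, hvu⟩) -
    · exact h.elim
    · refine (hC.mem_of_adj hu hvu.symm).resolve_right fun hvS => ?_
      obtain ⟨q, hq, hvq⟩ := hdom v (hSS' hvS)
      exact (mem_region_of_empty.1 hv).2 q hq hvq
  · refine hC.1.cutConn.subset_of_closed ⟨c, hc, subset_closureIn rfl⟩ fun a _ ha b hb hab => ?_
    exact mem_closureIn (mem_region_of_empty.2 (hfar b hb)) (Or.inr ⟨a, ha, hab.symm⟩)
      (Or.inl trivial)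

theorem IsMeshSet.exists_not_mem {A K : Set V} (h : IsMeshSet G A) (hne : A.Nonempty)
    (hKA : K ⊆ A) (hK : CutConn Gᶜ K) : ∃ y ∈ A, y ∉ K := by
  by_contra! hc
  exact h (connected_compl_of_cutConn hne (hKA.antisymm hc ▸ hK))

/-- `N(X) ∪ F` isolates the set `X` from the rest of the graph. -/
theorem subset_of_isComp_nbhd {X F C : Set V} (hC : IsComp G (nbhd G X ∪ F) C)
    (hne : (C ∩ X).Nonempty) : C ⊆ X := by
  refine hC.cutConn.subset_of_closed hne fun a _ ha b hb hab => ?_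
  by_contra hbX
  exact hC.subset_compl hb (Or.inl ⟨hbX, a, ha, hab.symm⟩)

/-- A surviving vertex of `A` must lie in `X`, and its component cannot leave `X ⊆ A ∪ S`. -/
theorem carvesAway_of_isolating {S A X F : Set V} (hA : IsFullComp G S A) (hXA : X ⊆ A ∪ S)
    (hAX : A ⊆ X ∪ nbhd G X) : CarvesAway G S (nbhd G X ∪ F) A := by
  rintro C hC ⟨v, hvC, hvA⟩ D hD hDA ⟨w, hwC, hwD⟩
  have hvX : v ∈ X := (hAX hvA).resolve_right fun h => hC.subset_compl hvC (Or.inl h)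
  have hwX := subset_of_isComp_nbhd hC ⟨v, hvC, hvX⟩ hwC
  rcases hXA hwX with h | h
  · exact hDA (hD.eq_of_inter hA.1 ⟨w, hwD, h⟩)
  · exact hD.subset_compl hwD h

/-- The vertices in no full component of a given pair, nor in the separator, are recognised by a
dominating set. -/
theorem exists_frame [Finite V] (hG : P6Free G) {S A B : Set V} (hA : IsFullComp G S A)
    (hB : IsFullComp G S B) (hAB : A ≠ B) {x y x' y' : V} (hx : x ∈ A) (hy : y ∈ A) (hx' : x' ∈ B)
    (hy' : y' ∈ B) (hdA : ∀ a ∈ A, G.Adj a x ∨ G.Adj a y) (hdB : ∀ b ∈ B, G.Adj b x' ∨ G.Adj b y') :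
    ∃ Q : Set V, Q.ncard ≤ 10 ∧ farFrom G Q = {v | v ∉ A ∧ v ∉ B ∧ v ∉ S} := by
  obtain ⟨Q, hQ, hcard, hdom⟩ := hA.exists_dominating hG hB hAB
  refine ⟨{x, y, x', y'} ∪ Q, ?_, ?_⟩
  · refine (Set.ncard_union_le _ _).trans (Nat.add_le_add (b := 4) ?_ hcard)
    refine (Set.ncard_insert_le _ _).trans (Nat.succ_le_succ ?_)
    refine (Set.ncard_insert_le _ _).trans (Nat.succ_le_succ ?_)
    refine (Set.ncard_insert_le _ _).trans (Nat.succ_le_succ ?_)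
    exact (Set.ncard_singleton _).le
  have hQ' : {x, y, x', y'} ∪ Q ⊆ A ∪ B := by
    rintro z ((rfl | rfl | rfl | rfl) | hz)
    · exact Or.inl hx
    · exact Or.inl hy
    · exact Or.inr hx'
    · exact Or.inr hy'
    · exact hQ hz
  ext v
  constructor
  · rintro ⟨-, hv⟩
    refine ⟨fun h => ?_, fun h => ?_, fun h => ?_⟩
    · rcases hdA v h with h | h <;> exact hv _ (by simp) h
    · rcases hdB v h with h | h <;> exact hv _ (by simp) h
    · obtain ⟨q, hq, hvq⟩ := hdom v h
      exact hv q (Or.inr hq) hvq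
  · rintro ⟨h1, h2, h3⟩
    refine ⟨fun h => (hQ' h).elim h1 h2, fun z hz h => ?_⟩
    rcases hQ' hz with hz | hz
    · rcases hA.mem_of_adj hz h.symm with h | h <;> contradiction
    · rcases hB.mem_of_adj hz h.symm with h | h <;> contradiction

/-- Of two distinct components of `G - S`, one is `A`, which `N(X)` isolates, or one is neither `A`
nor `B`. In the second case removing `F` confines a component to the vertices outside `A ∪ B ∪ S`,
where it cannot pass between components of `G - S`. -/
theorem carvesAway_of_frame {S A B X F : Set V} (hA : IsFullComp G S A) (hB : IsFullComp G S B)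
    (hXA : X ⊆ A ∪ S) (hAX : A ⊆ X ∪ nbhd G X)
    (hF : nbhd G {v | v ∉ A ∧ v ∉ B ∧ v ∉ S} ⊆ F) {D : Set V} (hD : IsComp G S D) :
    CarvesAway G S (nbhd G X ∪ F) D := by
  have hcA := carvesAway_of_isolating (F := F) hA hXA hAX
  rintro C hC hCD D' hD' hne hCD'
  by_cases hDA : D = A
  · subst hDA; exact hcA C hC hCD D' hD' hne hCD'
  by_cases hDA' : D' = A
  · subst hDA'; exact hcA C hC hCD' D hD (Ne.symm hne) hCD
  have key : ∀ E E' : Set V, IsComp G S E → IsComp G S E' → E ≠ A → E ≠ B → E' ≠ E →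
      (C ∩ E).Nonempty → (C ∩ E').Nonempty → False := by
    rintro E E' hE hE' hEA hEB hne ⟨v, hvC, hvE⟩ ⟨w, hwC, hwE'⟩
    have hEO : ∀ v ∈ E, v ∉ A ∧ v ∉ B ∧ v ∉ S := fun v hv =>
      ⟨fun h => hEA (hE.eq_of_inter hA.1 ⟨v, hv, h⟩), fun h => hEB (hE.eq_of_inter hB.1 ⟨v, hv, h⟩),
        hE.subset_compl hv⟩
    have hCO := hC.cutConn.subset_of_closed (X := {v | v ∉ A ∧ v ∉ B ∧ v ∉ S}) ⟨v, hvC, hEO v hvE⟩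
      fun a _ ha b hb hab => by
        by_contra hbO
        exact hC.subset_compl hb (Or.inr (hF ⟨hbO, a, ha, hab.symm⟩))
    have hCE := hC.cutConn.subset_of_closed (X := E) ⟨v, hvC, hvE⟩ fun a _ ha b hb hab =>
      hE.mem_of_adj ha hab (hCO hb).2.2
    exact hne (hE'.eq_of_inter hE ⟨w, hwE', hCE hwC⟩)
  by_cases hDB : D = B
  · exact key D' D hD' hD hDA' (fun h => hne (h.trans hDB.symm)) (Ne.symm hne) hCD' hCD
  · exact key D D' hD hD' hDA hDB hne hCD hCD'

theorem inter_eq_of_isolating {S X F P : Set V} (hN : nbhd G X ∩ P ⊆ S) (hFS : F ⊆ S)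
    (hSF : S ∩ P ⊆ F) : (nbhd G X ∪ F) ∩ P = S ∩ P := by
  ext v
  constructor
  · rintro ⟨h | h, hP⟩
    · exact ⟨hN ⟨h, hP⟩, hP⟩
    · exact ⟨hFS h, hP⟩
  · exact fun h => ⟨Or.inr (hSF h), h.2⟩

theorem frame_subset {S A B Q U : Set V} (hA : IsFullComp G S A) (hB : IsFullComp G S B)
    (hQ : farFrom G Q = {v | v ∉ A ∧ v ∉ B ∧ v ∉ S}) (hU : U ⊆ S) : frame G Q U ⊆ S := by
  rintro v (⟨hv, u, hu, hvu⟩ | hv)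
  · rw [hQ] at hu hv
    by_contra hvS
    refine hv ⟨fun h => ?_, fun h => ?_, hvS⟩
    · rcases hA.mem_of_adj h hvu with h | h
      · exact hu.1 h
      · exact hu.2.2 h
    · rcases hB.mem_of_adj h hvu with h | h
      · exact hu.2.1 h
      · exact hu.2.2 h
  · exact hU hv

/-- The vertex `x` dominates `A \ K`, and `y` dominates `K`. -/
theorem subset_union_nbhd {A K X : Set V} (hK : ∀ a ∈ K, ∀ b ∈ A, b ∉ K → G.Adj a b) {x y : V}
    (hx : x ∈ K) (hy : y ∈ A) (hyK : y ∉ K) (hxX : x ∈ X) (hyX : y ∈ X) : A ⊆ X ∪ nbhd G X := by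
  intro v hv
  by_cases hvX : v ∈ X
  · exact Or.inl hvX
  by_cases hvK : v ∈ K
  · exact Or.inr ⟨hvX, y, hyX, hK v hvK y hy hyK⟩
  · exact Or.inr ⟨hvX, x, hxX, (hK x hx v hv hvK).symm⟩

theorem exists_candidate_of_mixed [Finite V] (hG : P6Free G) {T : RootedForest V} {d : ℕ}
    (hT : T.IsTDStructure G d) {S A B : Set V} (hA : IsFullComp G S A) (hB : IsFullComp G S B)
    (hAB : A ≠ B) (hmA : IsMeshSet G A) (hmB : ¬ IsMeshSet G B) :
    ∃ (x y p q : V) (W : Set V), W.ncard ≤ d + 1 ∧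
      candidate G {y} {p, q} ∅ W (S ∩ T.verts) {x} True False ∩ T.verts = S ∩ T.verts ∧
      CarvesAway G S (candidate G {y} {p, q} ∅ W (S ∩ T.verts) {x} True False) A := by
  obtain ⟨K, hKA, ⟨x, hx⟩, hco, hcpl, hcard⟩ := T.exists_main_coComp hT hA.1.nonempty
  obtain ⟨y, hy, hyK⟩ := hmA.exists_not_mem hA.1.nonempty hKA hco
  obtain ⟨p, hp, q, hq, hpq⟩ := exists_pair_of_nonmesh hG hA hB hAB hmB
  set W : Set V := insert y {v | v ∈ A ∧ v ∉ K ∧ v ∈ T.verts}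
  set U := S ∩ T.verts with hU
  refine ⟨x, y, p, q, W, (Set.ncard_insert_le _ _).trans (Nat.succ_le_succ hcard), ?_⟩
  have hZ : {p, q} ⊆ B := by rintro _ (rfl | rfl) <;> assumption
  have hWA : W ⊆ A := by
    rintro v (rfl | hv)
    · exact hy
    · exact hv.1
  have hframe : frame G ∅ U = U := by
    ext v; simp [frame, nbhd, farFrom]
  set R := region G {y} {p, q} ∅ U with hR
  have hKR : K ⊆ R := fun a ha => by
    refine ⟨?_, hA.mem_farFrom hB hAB hZ (hKA ha), ?_⟩
    · rintro _ rfl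
      exact hcpl a ha _ hy hyK
    · rw [hframe]
      exact fun h => hA.1.subset_compl (hKA ha) h.1
  -- A neighbour of `y` lies in `A ∪ S`. Outside `K` it is complete to `K`: in `A` by the choice of
  -- the co-component, in `S` because it misses `p` and `q`.
  have h1 : closureIn G R True False {x} ⊆ K := by
    refine closureIn_subset (by simpa using hx) ?_
    rintro v hv - (h | ⟨u, hu, hvu⟩)
    · exact h.elim
    · by_contra hvK
      have hvy : G.Adj v y := hv.1 y rfl
      rcases hA.mem_of_adj hy hvy.symm with h | h
      · exact hvu (hcpl u hu v h hvK).symm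
      · exact hvu (hpq v h hv.2.1 u (hKA hu))
  have h2 : K ⊆ closureIn G R True False {x} := subset_closureIn_of_cutConn_compl hco hKR hx rfl
  have h3 : closureIn G R True False {x} ∪ W ⊆ A := Set.union_subset (h1.trans hKA) hWA
  have h4 : A ∩ T.verts ⊆ closureIn G R True False {x} ∪ W := by
    rintro v ⟨hvA, hvT⟩
    by_cases hvK : v ∈ K
    · exact Or.inl (h2 hvK)
    · exact Or.inr (Or.inr ⟨hvA, hvK, hvT⟩)
  unfold candidate
  rw [← hR, hframe]
  constructor
  · refine inter_eq_of_isolating ?_ Set.inter_subset_left subset_rfl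
    rintro v ⟨⟨hv, u, hu, hvu⟩, hvT⟩
    exact (hA.mem_of_adj (h3 hu) hvu.symm).resolve_left fun h => hv (h4 ⟨h, hvT⟩)
  · exact carvesAway_of_isolating hA (h3.trans Set.subset_union_left)
      (subset_union_nbhd hcpl hx hy hyK (Or.inl (h2 hx)) (Or.inr (Or.inl rfl)))

/-- A vertex of `S` with a neighbour in the co-component `K` of `B`, but seeing neither `b ∈ K` nor
`b' ∈ B \ K`, is joined to all vertices of `A ∪ S` that see neither `K` nor `b'`. -/
theorem adj_of_mixed_to_coComp (hG : P6Free G) {S A B K : Set V} (hA : IsFullComp G S A)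
    (hB : IsFullComp G S B) (hAB : A ≠ B) (hKB : K ⊆ B) (hco : CutConn Gᶜ K)
    (hcpl : ∀ a ∈ K, ∀ b ∈ B, b ∉ K → G.Adj a b) {b b' u h : V} (hb : b ∈ K) (hb' : b' ∈ B)
    (hbK' : b' ∉ K) (hu : u ∈ S) (huK : ∃ c ∈ K, G.Adj u c) (hub : ¬ G.Adj u b)
    (hub' : ¬ G.Adj u b') (hh : h ∈ A ∨ h ∈ S) (hhK : ∀ c ∈ K, ¬ G.Adj h c)
    (hhb' : ¬ G.Adj h b') : G.Adj u h := by
  obtain ⟨c, hc, huc⟩ := huK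
  -- A non-edge of `K` split by `u` gives the induced path `u s b' t`, so `u` is complete to `A`. If
  -- `h ∈ S` were not adjacent to `u`, a neighbour `a` of `h` in `A` would extend it to `h a u s b'
  -- t`.
  obtain ⟨s, hs, hus, t, ht, hut, hst⟩ := hco {z | G.Adj u z} ⟨c, hc, huc⟩ ⟨b, hb, hub⟩
  have hst' : ¬ G.Adj s t := ((SimpleGraph.compl_adj _ _ _).1 hst).2
  have hsb' := hcpl s hs b' hb' hbK'
  have htb' := hcpl t ht b' hb' hbK'
  have hnot : ∀ a ∈ A, ∀ b ∈ B, ¬ G.Adj a b := fun _ ha _ hb => hA.not_adj hB hAB ha hb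
  have hcA : ∀ a ∈ A, G.Adj u a := by
    refine PathInto.complete hG hA.1.cutConn hnot (hA.exists_adj hu)
      ⟨s, hKB hs, b', hb', t, hKB ht, hus, hsb', htb'.symm, hub', hut, hst'⟩
  rcases hh with hh | hh
  · exact hcA h hh
  · by_contra huh
    obtain ⟨a, ha, hha⟩ := hA.exists_adj hh
    exact hG.no_path hha (hcA a ha).symm hus hsb' htb'.symm (fun h => huh h.symm) (hhK s hs) hhb'
      (hhK t ht) (hnot a ha s (hKB hs)) (hnot a ha b' hb') (hnot a ha t (hKB ht)) hub' hut hst'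

/-- Unlike in the mixed case, the closure need not stay in `A`. It suffices that its vertices in `S`
have no forest neighbours outside `A ∪ S`: the part of the forest in `B \ L` is guessed in `Z`, the
co-component `L` is avoided by `adj_of_mixed_to_coComp`, and the other components are avoided
because the frame contains the neighbourhood of their union. -/
theorem exists_candidate_of_mesh [Finite V] (hG : P6Free G) {T : RootedForest V} {d : ℕ}
    (hT : T.IsTDStructure G d) {S A B : Set V} (hA : IsFullComp G S A) (hB : IsFullComp G S B)
    (hAB : A ≠ B) (hmA : IsMeshSet G A) (hmB : IsMeshSet G B) :
    ∃ (x y : V) (Z Q W : Set V), Z.ncard ≤ d + 2 ∧ Q.ncard ≤ 10 ∧ W.ncard ≤ d + 1 ∧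
      candidate G {y} Z Q W (S ∩ T.verts) {x} True False ∩ T.verts = S ∩ T.verts ∧
      ∀ D, IsComp G S D →
        CarvesAway G S (candidate G {y} Z Q W (S ∩ T.verts) {x} True False) D := by
  obtain ⟨K, hKA, ⟨x, hx⟩, hco, hcpl, hcard⟩ := T.exists_main_coComp hT hA.1.nonempty
  obtain ⟨y, hy, hyK⟩ := hmA.exists_not_mem hA.1.nonempty hKA hco
  obtain ⟨L, hLB, ⟨x', hx'⟩, hco', hcpl', hcard'⟩ := T.exists_main_coComp hT hB.1.nonempty
  obtain ⟨y', hy', hyL'⟩ := hmB.exists_not_mem hB.1.nonempty hLB hco'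
  have hdom : ∀ {A K : Set V} {x y : V}, (∀ a ∈ K, ∀ b ∈ A, b ∉ K → G.Adj a b) → x ∈ K → y ∈ A →
      y ∉ K → ∀ a ∈ A, G.Adj a x ∨ G.Adj a y := by
    intro A K x y hc hx hy hyK a ha
    by_cases haK : a ∈ K
    · exact Or.inr (hc a haK y hy hyK)
    · exact Or.inl (hc x hx a ha haK).symm
  obtain ⟨Q, hQcard, hQ⟩ := exists_frame hG hA hB hAB (hKA hx) hy (hLB hx') hy'
    (hdom hcpl hx hy hyK) (hdom hcpl' hx' hy' hyL')
  set W : Set V := insert y {v | v ∈ A ∧ v ∉ K ∧ v ∈ T.verts}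
  set Z : Set V := insert x' (insert y' {v | v ∈ B ∧ v ∉ L ∧ v ∈ T.verts})
  set U := S ∩ T.verts with hU
  have hZB : Z ⊆ B := by
    rintro v (rfl | rfl | hv)
    · exact hLB hx'
    · exact hy'
    · exact hv.1
  have hWA : W ⊆ A := by
    rintro v (rfl | hv)
    · exact hy
    · exact hv.1
  refine ⟨x, y, Z, Q, W, ?_, hQcard,
    (Set.ncard_insert_le _ _).trans (Nat.succ_le_succ hcard), ?_⟩
  · refine (Set.ncard_insert_le _ _).trans (Nat.succ_le_succ ?_)
    exact (Set.ncard_insert_le _ _).trans (Nat.succ_le_succ hcard')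
  have hFS : frame G Q U ⊆ S := frame_subset hA hB hQ Set.inter_subset_left
  set R := region G {y} Z Q U with hR
  have hRAS : ∀ v ∈ R, v ∈ A ∨ v ∈ S := fun v hv => hA.mem_of_adj hy (hv.1 y rfl).symm
  have hKR : K ⊆ R := fun a ha => by
    refine ⟨?_, hA.mem_farFrom hB hAB hZB (hKA ha), fun h => hA.1.subset_compl (hKA ha) (hFS h)⟩
    rintro _ rfl
    exact hcpl a ha _ hy hyK
  -- Having no neighbour in `L` is preserved: a permitted vertex of `S` violating it would be
  -- adjacent to every vertex collected so far, so the non-neighbour rule cannot add it.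
  have h1 : closureIn G R True False {x} ⊆ {v | v ∈ R ∧ ∀ c ∈ L, ¬ G.Adj v c} := by
    refine closureIn_subset ?_ ?_
    · rintro _ rfl
      exact ⟨hKR hx, fun c hc => hA.not_adj hB hAB (hKA hx) (hLB hc)⟩
    · rintro v hv - (h | ⟨u, ⟨hu, huL⟩, hvu⟩)
      · exact h.elim
      · refine ⟨hv, ?_⟩
        by_contra! hvL
        have hvS : v ∈ S := (hRAS v hv).resolve_left fun h => by
          obtain ⟨c, hc, hvc⟩ := hvL
          exact hA.not_adj hB hAB h (hLB hc) hvc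
        exact hvu (adj_of_mixed_to_coComp hG hA hB hAB hLB hco' hcpl' hx' hy' hyL' hvS hvL
          (hv.2.1.2 x' (Or.inl rfl)) (hv.2.1.2 y' (Or.inr (Or.inl rfl))) (hRAS u hu) huL
          (hu.2.1.2 y' (Or.inr (Or.inl rfl))))
  have h2 : K ⊆ closureIn G R True False {x} := subset_closureIn_of_cutConn_compl hco hKR hx rfl
  have h3 : closureIn G R True False {x} ∪ W ⊆ A ∪ S :=
    Set.union_subset (fun v hv => hRAS v (h1 hv).1) (hWA.trans Set.subset_union_left)
  have h4 : A ∩ T.verts ⊆ closureIn G R True False {x} ∪ W := by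
    rintro v ⟨hvA, hvT⟩
    by_cases hvK : v ∈ K
    · exact Or.inl (h2 hvK)
    · exact Or.inr (Or.inr ⟨hvA, hvK, hvT⟩)
  unfold candidate
  rw [← hR]
  constructor
  · refine inter_eq_of_isolating ?_ hFS Set.subset_union_right
    rintro v ⟨⟨hv, u, hu, hvu⟩, hvT⟩
    by_contra hvS
    have hvA : v ∉ A := fun h => hv (h4 ⟨h, hvT⟩)
    by_cases huA : u ∈ A
    · rcases hA.mem_of_adj huA hvu.symm with h | h <;> contradiction
    have huS : u ∈ S := (h3 hu).resolve_left huA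
    obtain ⟨huR, huL⟩ := h1 (hu.resolve_right fun h => huA (hWA h))
    by_cases hvB : v ∈ B
    · by_cases hvL : v ∈ L
      · exact huL v hvL hvu.symm
      · exact huR.2.1.2 v (Or.inr (Or.inr ⟨hvB, hvL, hvT⟩)) hvu.symm
    · refine huR.2.2 (Or.inl ?_)
      rw [hQ]
      exact ⟨fun h => h.2.2 huS, v, ⟨hvA, hvB, hvS⟩, hvu.symm⟩
  · intro D hD
    refine carvesAway_of_frame hA hB h3
      (subset_union_nbhd hcpl hx hy hyK (Or.inl (h2 hx)) (Or.inr (Or.inl rfl))) ?_ hD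
    rw [← hQ]
    exact Set.subset_union_left

/-- For every separator to be carved there is a suitable candidate given by few vertices. -/
theorem exists_carver_candidate [Finite V] (hG : P6Free G) {T : RootedForest V} {d : ℕ}
    (hT : T.IsTDStructure G d) {S : Set V} (hS : IsMinSep G S)
    (hpath : T.InVerticalPath (S ∩ T.verts)) :
    ∃ (Y Z Q W U X : Set V) (b₁ b₂ : Prop), Y.ncard ≤ 1 ∧ Z.ncard ≤ d + 10 ∧ Q.ncard ≤ d + 10 ∧
      W.ncard ≤ d + 10 ∧ U.ncard ≤ d + 10 ∧ X.ncard ≤ d + 10 ∧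
      T.IsCarver G S (candidate G Y Z Q W U X b₁ b₂) := by
  have hpair : ∀ a b : V, ({a, b} : Set V).ncard ≤ d + 10 := fun a b =>
    (Set.ncard_insert_le _ _).trans (by rw [Set.ncard_singleton]; omega)
  have hUc := T.ncard_le_of_inVerticalPath hT hpath
  by_cases hsub : IsSubordinate G S
  · obtain ⟨Z, c, hZ, hc⟩ := exists_candidate_of_subordinate hG hsub
    refine ⟨∅, Z, ∅, ∅, ∅, {c}, False, True, by simp, by omega, by simp, by simp, by simp, by simp,
      ?_⟩
    rw [hc]
    exact ⟨rfl, fun _ => rfl, fun h => absurd hsub h.2.1, fun h => absurd hsub h.2.1⟩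
  obtain ⟨A, B, hAB, hA, hB⟩ := hS
  by_cases h2 : ∃ A B, A ≠ B ∧ A ∈ meshFullComps G S ∧ B ∈ meshFullComps G S
  · obtain ⟨A, B, hAB, ⟨hA, hmA⟩, ⟨hB, hmB⟩⟩ := h2
    obtain ⟨x, y, Z, Q, W, hZ, hQ, hW, h, hcarve⟩ :=
      exists_candidate_of_mesh hG hT hA hB hAB hmA hmB
    refine ⟨{y}, Z, Q, W, _, {x}, True, False, by simp, by omega, by omega, by omega, by omega,
      by simp, h, ?_, fun _ A hA _ => hcarve A hA.1, fun _ => hcarve⟩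
    rintro (h | h)
    · exact absurd h hsub
    · have := Set.encard_eq_zero.1 h.2.2
      exact absurd (show A ∈ meshFullComps G S from ⟨hA, hmA⟩) (by simp [this])
  by_cases h1 : ∃ A, A ∈ meshFullComps G S
  · obtain ⟨M, hM⟩ := h1
    obtain ⟨B, hMB, hB⟩ : ∃ B, M ≠ B ∧ IsFullComp G S B := by
      by_cases h : M = A
      · exact ⟨B, h ▸ hAB, hB⟩
      · exact ⟨A, h, hA⟩
    have huniq : ∀ D ∈ meshFullComps G S, D = M := fun D hD => by
      by_contra h
      exact h2 ⟨D, M, h, hD, hM⟩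
    obtain ⟨x, y, p, q, W, hW, h, hcarve⟩ := exists_candidate_of_mixed hG hT hM.1 hB hMB hM.2
      fun hmB => hMB (huniq B ⟨hB, hmB⟩).symm
    refine ⟨{y}, {p, q}, ∅, W, _, {x}, True, False, by simp, hpair p q, by simp, by omega, by omega,
      by simp, h, ?_, fun _ D hD hmD => huniq D ⟨hD, hmD⟩ ▸ hcarve, fun hmesh => ?_⟩
    · rintro (h | h)
      · exact absurd h hsub
      · have := Set.encard_eq_zero.1 h.2.2
        exact absurd hM (by simp [this])
    · obtain ⟨D, D', hne, heq⟩ := Set.encard_eq_two.1 hmesh.2.2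
      exact absurd ⟨D, D', hne, by simp [heq], by simp [heq]⟩ h2
  · have hno : ∀ D, IsFullComp G S D → ¬ IsMeshSet G D := fun D hD hmD => h1 ⟨D, hD, hmD⟩
    obtain ⟨p, q, p', q', h⟩ := exists_candidate_of_nonmesh hG hA hB hAB (hno A hA) (hno B hB)
    refine ⟨∅, {p', q'}, ∅, ∅, ∅, {p, q}, False, False, by simp, hpair _ _, by simp, by simp,
      by simp, hpair _ _, ?_⟩
    rw [h]
    refine ⟨rfl, fun _ => rfl, fun _ D hD hmD => absurd hmD (hno D hD), fun hmesh => ?_⟩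
    obtain ⟨D, D', hne, heq⟩ := Set.encard_eq_two.1 hmesh.2.2
    exact absurd ⟨D, by simp [heq]⟩ h1

end Candidates

/-! ### Loops and definable sets on the machine -/

section Programs

/-- The state with the variable `x` set to `k`. -/
def State.setVar (s : State) (x k : ℕ) : State := { s with var := Function.update s.var x k }

theorem State.setVar_var_self (s : State) (x k : ℕ) : (s.setVar x k).var x = k := by
  simp [State.setVar]

theorem State.setVar_var_of_ne (s : State) {x y : ℕ} (k : ℕ) (h : y ≠ x) :
    (s.setVar x k).var y = s.var y := by
  simp [State.setVar, h]

@[simp] theorem State.setVar_arr (s : State) (x k : ℕ) : (s.setVar x k).arr = s.arr := rfl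

@[simp] theorem State.setVar_out (s : State) (x k : ℕ) : (s.setVar x k).out = s.out := rfl

/-- `for x := 0, …, hi - 1 do c` -/
def forLoop (x : ℕ) (hi : Expr) (c : Prog) : Prog :=
  .seq (.assign x (.const 0))
    (.loop (.lt (.var x) hi) (.seq c (.assign x (.add (.var x) (.const 1)))))

/-- The invariant `I` fixes the counter and the value of the bound, which is evaluated anew at each
test. Each round pays `hi.cost + 3` for the test and `4` for the increment besides the body;
initialisation costs `2`. -/
theorem exec_forLoop {x : ℕ} {hi : Expr} {c : Prog} {N p : ℕ} (I : ℕ → State → Prop) {s : State}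
    (h0 : I 0 (s.setVar x 0)) (hI : ∀ i s, I i s → s.var x = i ∧ hi.eval s = N)
    (hstep : ∀ i < N, ∀ s, I i s → ∃ t ≤ p, ∃ s', Exec c s t s' ∧
      I (i + 1) (s'.setVar x (s'.var x + 1))) :
    ∃ t ≤ N * (hi.cost + p + 7) + (hi.cost + 5), ∃ s', Exec (forLoop x hi c) s t s' ∧ I N s' := by
  have key : ∀ k i s, i + k = N → I i s → ∃ t ≤ k * (hi.cost + p + 7) + (hi.cost + 3), ∃ s',
      Exec (.loop (.lt (.var x) hi) (.seq c (.assign x (.add (.var x) (.const 1))))) s t s' ∧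
        I N s' := by
    intro k
    induction k with
    | zero =>
      intro i s hi' hs
      obtain ⟨h1, h2⟩ := hI i s hs
      refine ⟨_, ?_, s, Exec.loop_false ?_, ?_⟩
      · simp only [Expr.cost]; omega
      · simp only [Expr.eval, h1, h2]; rw [if_neg (by omega)]
      · simpa [← hi'] using hs
    | succ k ih =>
      intro i s hi' hs
      obtain ⟨h1, h2⟩ := hI i s hs
      obtain ⟨t, ht, s', hex, hs'⟩ := hstep i (by omega) s hs
      obtain ⟨t', ht', s'', hex', hs''⟩ := ih (i + 1) _ (by omega) hs'
      refine ⟨_, ?_, s'', Exec.loop_true ?_ (Exec.seq hex (Exec.assign _ _ _)) hex', hs''⟩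
      · simp only [Expr.cost]
        have : (k + 1) * (hi.cost + p + 7) = k * (hi.cost + p + 7) + (hi.cost + p + 7) := by ring
        omega
      · simp only [Expr.eval, h1, h2]; rw [if_pos (by omega)]; exact one_ne_zero
  obtain ⟨t, ht, s', hex, hs'⟩ := key N 0 _ (by omega) h0
  refine ⟨_, ?_, s', Exec.seq (Exec.assign _ _ _) hex, hs'⟩
  simp only [Expr.cost]
  omega

/-- Negation. -/
def Expr.neg (e : Expr) : Expr := .eq e (.const 0)

/-- Conjunction. -/
def Expr.conj (e f : Expr) : Expr := .neg (.add (.neg e) (.neg f))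

@[simp] theorem Expr.eval_neg (s : State) (e : Expr) : (e.neg.eval s = 0) ↔ e.eval s ≠ 0 := by
  by_cases h : e.eval s = 0 <;> simp [Expr.neg, Expr.eval, h]

@[simp] theorem Expr.eval_conj (s : State) (e f : Expr) :
    ((e.conj f).eval s = 0) ↔ (e.eval s = 0 ∨ f.eval s = 0) := by
  rw [Expr.conj, Expr.eval_neg]
  simp only [Expr.eval, ne_eq, Nat.add_eq_zero_iff, Expr.eval_neg]
  tauto

@[simp] theorem Expr.eval_add (s : State) (e f : Expr) :
    ((Expr.add e f).eval s = 0) ↔ (e.eval s = 0 ∧ f.eval s = 0) := by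
  simp [Expr.eval]

@[simp] theorem Expr.eval_eq (s : State) (e f : Expr) :
    ((Expr.eq e f).eval s = 0) ↔ (e.eval s ≠ f.eval s) := by
  simp [Expr.eval]

@[simp] theorem Expr.eval_lt (s : State) (e f : Expr) :
    ((Expr.lt e f).eval s = 0) ↔ ¬ (e.eval s < f.eval s) := by
  simp [Expr.eval]

@[simp] theorem Expr.eval_const (s : State) (c : ℕ) : (Expr.const c).eval s = c := rfl

@[simp] theorem Expr.eval_var (s : State) (x : ℕ) : (Expr.var x).eval s = s.var x := rfl

@[simp] theorem Expr.eval_read (s : State) (a : ℕ) (i j : Expr) :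
    (Expr.read a i j).eval s = s.arr a (i.eval s) (j.eval s) := rfl

/-- The value of the variable `x` is among the values of the variables in `l`. -/
def Expr.memVars (x : ℕ) (l : List ℕ) : Expr :=
  l.foldr (fun i e => .add (.eq (.var x) (.var i)) e) (.const 0)

/-- The vertex `x` is adjacent to the value of a variable in `l`. -/
def Expr.adjVars (x : ℕ) (l : List ℕ) : Expr :=
  l.foldr (fun i e => .add (.read 0 (.var x) (.var i)) e) (.const 0)

@[simp] theorem Expr.eval_memVars (s : State) (x : ℕ) (l : List ℕ) :
    (Expr.memVars x l).eval s = 0 ↔ ∀ i ∈ l, s.var x ≠ s.var i := by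
  induction l with
  | nil => simp [Expr.memVars]
  | cons i l ih =>
    rw [show Expr.memVars x (i :: l) = .add (.eq (.var x) (.var i)) (.memVars x l) from rfl]
    simp [ih]

@[simp] theorem Expr.eval_adjVars (s : State) (x : ℕ) (l : List ℕ) :
    (Expr.adjVars x l).eval s = 0 ↔ ∀ i ∈ l, s.arr 0 (s.var x) (s.var i) = 0 := by
  induction l with
  | nil => simp [Expr.adjVars]
  | cons i l ih =>
    rw [show Expr.adjVars x (i :: l) = .add (.read 0 (.var x) (.var i)) (.adjVars x l) from rfl]
    simp [ih]

/-- For every vertex `v` (variable `1`), set the cell `(v, 0)` of the array `a` to the value of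
`e`, which may use the variables `3` and `4`: they tell whether there is a vertex `u` (variable
`2`) satisfying `e₁` or `e₂`, respectively. -/
def setDef (a : ℕ) (e₁ e₂ e : Expr) : Prog :=
  forLoop 1 (.var 0) (.seq (.assign 3 (.const 0)) (.seq (.assign 4 (.const 0)) (.seq
    (forLoop 2 (.var 0) (.seq (.ite e₁ (.assign 3 (.const 1)) .skip)
      (.ite e₂ (.assign 4 (.const 1)) .skip)))
    (.store a (.var 1) (.const 0) e))))

/-- The states differ only in the variables `1` to `4` and in the array `a`. -/
def Agree (a : ℕ) (s s' : State) : Prop :=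
  s'.var 0 = s.var 0 ∧ (∀ i ≥ 5, s'.var i = s.var i) ∧ (∀ b ≠ a, s'.arr b = s.arr b) ∧
    s'.out = s.out

theorem Agree.setVar {a : ℕ} {s s' : State} (h : Agree a s s') {x : ℕ} (k : ℕ) (hx : x ≠ 0)
    (hx' : x < 5) : Agree a s (s'.setVar x k) := by
  refine ⟨?_, fun i hi => ?_, h.2.2.1, h.2.2.2⟩
  · rw [State.setVar_var_of_ne _ _ hx.symm]; exact h.1
  · rw [State.setVar_var_of_ne _ _ (by omega)]; exact h.2.1 i hi

/-- The array `a` holds the characteristic function of `X`. -/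
def Rep {n : ℕ} (s : State) (a : ℕ) (X : Set (Fin n)) : Prop :=
  ∀ v : Fin n, s.arr a v 0 ≠ 0 ↔ v ∈ X

theorem exec_ite_assign (e : Expr) (x : ℕ) (s : State) : ∃ t ≤ e.cost + 3,
    Exec (.ite e (.assign x (.const 1)) .skip) s t
      (if e.eval s ≠ 0 then s.setVar x 1 else s) := by
  by_cases h : e.eval s ≠ 0
  · refine ⟨_, ?_, by rw [if_pos h]; exact Exec.ite_true h (Exec.assign _ _ _)⟩
    simp only [Expr.cost]; omega
  · refine ⟨_, ?_, by rw [if_neg h]; exact Exec.ite_false (not_not.1 h) (Exec.skip _)⟩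
    omega

/-- Every stage of the closure procedure is defined by at most two existential conditions on a
second vertex, so this double loop serves for all of them. `Agree` leaves the array `a`
unconstrained, so the expressions must not depend on it; sets are therefore updated via a second
array. -/
theorem exec_setDef (a : ℕ) (e₁ e₂ e : Expr) : ∃ p : Polynomial ℕ, ∀ (n : ℕ) (s : State),
    s.var 0 = n → ∀ (P₁ P₂ : Fin n → Fin n → Prop) (P : Fin n → Prop → Prop → Prop),
    (∀ s', Agree a s s' → ∀ v u : Fin n, s'.var 1 = v → s'.var 2 = u →
      (e₁.eval s' ≠ 0 ↔ P₁ v u)) →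
    (∀ s', Agree a s s' → ∀ v u : Fin n, s'.var 1 = v → s'.var 2 = u →
      (e₂.eval s' ≠ 0 ↔ P₂ v u)) →
    (∀ s', Agree a s s' → ∀ v : Fin n, s'.var 1 = v →
      (e.eval s' ≠ 0 ↔ P v (s'.var 3 ≠ 0) (s'.var 4 ≠ 0))) →
    ∃ t ≤ p.eval n, ∃ s', Exec (setDef a e₁ e₂ e) s t s' ∧ Agree a s s' ∧
      Rep s' a {v | P v (∃ u, P₁ v u) (∃ u, P₂ v u)} := by
  refine ⟨.X * (.X * .C (e₁.cost + e₂.cost + 14) + .C (e.cost + 21)) + .C 6, ?_⟩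
  intro n s hn P₁ P₂ P h₁ h₂ h
  let I : ℕ → State → Prop := fun i s' => Agree a s s' ∧ s'.var 1 = i ∧
    ∀ v : Fin n, v.1 < i → (s'.arr a v 0 ≠ 0 ↔ P v (∃ u, P₁ v u) (∃ u, P₂ v u))
  suffices hstep : ∀ i < n, ∀ s, I i s → ∃ t ≤ n * (e₁.cost + e₂.cost + 14) + (e.cost + 13), ∃ s',
      Exec (.seq (.assign 3 (.const 0)) (.seq (.assign 4 (.const 0)) (.seq
        (forLoop 2 (.var 0) (.seq (.ite e₁ (.assign 3 (.const 1)) .skip)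
          (.ite e₂ (.assign 4 (.const 1)) .skip))) (.store a (.var 1) (.const 0) e)))) s t s' ∧
        I (i + 1) (s'.setVar 1 (s'.var 1 + 1)) by
    obtain ⟨t, ht, s', hex, hA, -, hs'⟩ := exec_forLoop (hi := .var 0) I (s := s)
      ⟨Agree.setVar ⟨rfl, fun _ _ => rfl, fun _ _ => rfl, rfl⟩ 0 (by norm_num) (by norm_num),
        State.setVar_var_self _ _ _, fun v hv => absurd hv (Nat.not_lt_zero _)⟩
      (fun i s' hs' => ⟨hs'.2.1, by simp [hs'.1.1, hn]⟩) hstep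
    refine ⟨t, ht.trans ?_, s', hex, hA, fun v => hs' v v.2⟩
    simp only [Expr.cost, Polynomial.eval_add, Polynomial.eval_mul, Polynomial.eval_X,
      Polynomial.eval_C]
    refine Nat.add_le_add (Nat.mul_le_mul_left _ ?_) le_rfl
    omega
  intro i hi s₁ ⟨hA₁, hv₁, hs₁⟩
  let v : Fin n := ⟨i, hi⟩
  let s₂ := (s₁.setVar 3 0).setVar 4 0
  have hA₂ : Agree a s s₂ :=
    (hA₁.setVar 0 (by norm_num) (by norm_num)).setVar 0 (by norm_num) (by norm_num)
  have hv₂ : s₂.var 1 = i := by simp [s₂, State.setVar, hv₁]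
  let J : ℕ → State → Prop := fun j s' => Agree a s s' ∧ s'.var 1 = i ∧ s'.var 2 = j ∧
    s'.arr = s₁.arr ∧ (s'.var 3 ≠ 0 ↔ ∃ u : Fin n, u.1 < j ∧ P₁ v u) ∧
    (s'.var 4 ≠ 0 ↔ ∃ u : Fin n, u.1 < j ∧ P₂ v u)
  suffices hstep : ∀ j < n, ∀ s, J j s → ∃ t ≤ e₁.cost + e₂.cost + 6, ∃ s',
      Exec (.seq (.ite e₁ (.assign 3 (.const 1)) .skip) (.ite e₂ (.assign 4 (.const 1)) .skip))
        s t s' ∧ J (j + 1) (s'.setVar 2 (s'.var 2 + 1)) by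
    obtain ⟨t, ht, s₃, hex, hA₃, hv₃, -, harr, hc₁, hc₂⟩ := exec_forLoop (hi := .var 0) J (s := s₂)
      ⟨hA₂.setVar 0 (by norm_num) (by norm_num), by simp [State.setVar, s₂, hv₁],
        State.setVar_var_self _ _ _, rfl, by simp [State.setVar, s₂],
        by simp [State.setVar, s₂]⟩
      (fun i s' hs' => ⟨hs'.2.2.1, by simp [hs'.1.1, hn]⟩) hstep
    refine ⟨_, ?_, _, Exec.seq (Exec.assign _ _ _) (Exec.seq (Exec.assign _ _ _)
      (Exec.seq hex (Exec.store _ _ _ _ _))), ?_, ?_, ?_⟩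
    · simp only [Expr.cost] at ht ⊢
      have : n * (1 + (e₁.cost + e₂.cost + 6) + 7) = n * (e₁.cost + e₂.cost + 14) := by ring
      omega
    · apply Agree.setVar _ _ (by norm_num) (by norm_num)
      refine ⟨hA₃.1, hA₃.2.1, fun b hb => ?_, hA₃.2.2.2⟩
      rw [← hA₃.2.2.1 b hb]
      ext i' j'
      simp [hb]
    · simp [State.setVar, hv₃]
    · intro w hw
      have hval := h s₃ hA₃ v hv₃
      have hc₁' : s₃.var 3 ≠ 0 ↔ ∃ u, P₁ v u := hc₁.trans ⟨fun ⟨u, hu⟩ => ⟨u, hu.2⟩,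
        fun ⟨u, hu⟩ => ⟨u, u.2, hu⟩⟩
      have hc₂' : s₃.var 4 ≠ 0 ↔ ∃ u, P₂ v u := hc₂.trans ⟨fun ⟨u, hu⟩ => ⟨u, hu.2⟩,
        fun ⟨u, hu⟩ => ⟨u, u.2, hu⟩⟩
      rw [hc₁', hc₂'] at hval
      rcases Nat.lt_succ_iff_lt_or_eq.1 hw with hw | hw
      · simp [hv₃, hw.ne, harr, hs₁ w hw]
      · have : w = v := Fin.ext hw
        subst this
        simpa [hv₃, v] using hval
  intro j hj s₄ ⟨hA₄, hv₄, hu₄, harr₄, hc₁, hc₂⟩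
  let u : Fin n := ⟨j, hj⟩
  have hlt : ∀ R : Fin n → Prop, (∃ w : Fin n, w.1 < j + 1 ∧ R w) ↔
      (∃ w : Fin n, w.1 < j ∧ R w) ∨ R u := by
    intro R
    constructor
    · rintro ⟨w, hw, hR⟩
      rcases Nat.lt_succ_iff_lt_or_eq.1 hw with hw | hw
      · exact Or.inl ⟨w, hw, hR⟩
      · right; rwa [← show w = u from Fin.ext hw]
    · rintro (⟨w, hw, hR⟩ | hR)
      · exact ⟨w, by omega, hR⟩
      · exact ⟨u, Nat.lt_succ_self j, hR⟩
  obtain ⟨t₁, ht₁, hex₁⟩ := exec_ite_assign e₁ 3 s₄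
  set s₅ := if e₁.eval s₄ ≠ 0 then s₄.setVar 3 1 else s₄ with hs₅
  obtain ⟨t₂, ht₂, hex₂⟩ := exec_ite_assign e₂ 4 s₅
  set s₆ := if e₂.eval s₅ ≠ 0 then s₅.setVar 4 1 else s₅ with hs₆
  have H₁ := h₁ s₄ hA₄ v u hv₄ hu₄
  have hA₅ : Agree a s s₅ := by
    rw [hs₅]; split_ifs
    · exact hA₄.setVar 1 (by norm_num) (by norm_num)
    · exact hA₄
  have hx₅ : ∀ x, x ≠ 3 → s₅.var x = s₄.var x := by
    intro x hx
    rw [hs₅]; split_ifs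
    · exact State.setVar_var_of_ne _ _ hx
    · rfl
  have hc₅ : s₅.var 3 ≠ 0 ↔ ∃ w : Fin n, w.1 < j + 1 ∧ P₁ v w := by
    rw [hlt, ← hc₁, ← H₁, hs₅]
    split_ifs with hif
    · simp [State.setVar, hif]
    · simp [not_not.1 hif]
  have harr₅ : s₅.arr = s₁.arr := by
    rw [hs₅]; split_ifs <;> exact harr₄
  have H₂ := h₂ s₅ hA₅ v u ((hx₅ 1 (by norm_num)).trans hv₄) ((hx₅ 2 (by norm_num)).trans hu₄)
  have hA₆ : Agree a s s₆ := by
    rw [hs₆]; split_ifs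
    · exact hA₅.setVar 1 (by norm_num) (by norm_num)
    · exact hA₅
  have hx₆ : ∀ x, x ≠ 4 → s₆.var x = s₅.var x := by
    intro x hx
    rw [hs₆]; split_ifs
    · exact State.setVar_var_of_ne _ _ hx
    · rfl
  have hc₆ : s₆.var 4 ≠ 0 ↔ ∃ w : Fin n, w.1 < j + 1 ∧ P₂ v w := by
    rw [hlt, ← hc₂, ← H₂, ← hx₅ 4 (by norm_num), hs₆]
    split_ifs with hif
    · simp [State.setVar, hif]
    · simp [not_not.1 hif]
  have harr₆ : s₆.arr = s₁.arr := by
    rw [hs₆]; split_ifs <;> exact harr₅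
  refine ⟨_, ?_, s₆, Exec.seq hex₁ hex₂, hA₆.setVar _ (by norm_num) (by norm_num), ?_, ?_, harr₆,
    ?_, ?_⟩
  · omega
  · rw [State.setVar_var_of_ne _ _ (by norm_num), hx₆ 1 (by norm_num), hx₅ 1 (by norm_num), hv₄]
  · rw [State.setVar_var_self, hx₆ 2 (by norm_num), hx₅ 2 (by norm_num), hu₄]
  · rw [State.setVar_var_of_ne _ _ (by norm_num), hx₆ 3 (by norm_num), hc₅]
  · rw [State.setVar_var_of_ne _ _ (by norm_num), hc₆]

end Programs

/-! ### Computing one candidate from its guesses -/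

section Algorithm

/-- The state holds the graph `G` as input. -/
def Holds {n : ℕ} (G : SimpleGraph (Fin n)) (s : State) : Prop :=
  s.var 0 = n ∧ s.arr 0 = (inputState G).arr 0

theorem Holds.adj_iff {n : ℕ} {G : SimpleGraph (Fin n)} {s : State} (h : Holds G s)
    (u v : Fin n) : s.arr 0 u v = 0 ↔ ¬ G.Adj u v := by
  rw [h.2]
  simp [inputState]

/-- The number `k` may be out of range, as for the dummy value `n` of a guess; the adjacency array
is zero there. -/
theorem Holds.adj_iff' {n : ℕ} {G : SimpleGraph (Fin n)} {s : State} (h : Holds G s)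
    (u : Fin n) (k : ℕ) : s.arr 0 u k = 0 ↔ ∀ v : Fin n, k = v → ¬ G.Adj u v := by
  constructor
  · rintro hk v rfl
    exact (h.adj_iff u v).1 hk
  · intro hk
    rw [h.2]
    simp only [inputState, ite_eq_right_iff, one_ne_zero, imp_false, not_and]
    rintro - ⟨_, hk', hadj⟩
    exact hk ⟨k, hk'⟩ rfl hadj

theorem Agree.holds {n : ℕ} {G : SimpleGraph (Fin n)} {a : ℕ} {s s' : State} (hA : Agree a s s')
    (ha : a ≠ 0) (h : Holds G s) : Holds G s' :=
  ⟨hA.1.trans h.1, (hA.2.2.1 0 ha.symm).trans h.2⟩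

theorem Agree.rep {n a b : ℕ} {X : Set (Fin n)} {s s' : State} (hA : Agree a s s') (hab : b ≠ a)
    (h : Rep s b X) : Rep s' b X := by
  intro v
  rw [hA.2.2.1 b hab]
  exact h v

theorem Rep.eq_zero_iff {n a : ℕ} {X : Set (Fin n)} {s : State} (h : Rep s a X) (v : Fin n) :
    s.arr a v 0 = 0 ↔ v ∉ X := by
  rw [← h v, not_not]

/-- The vertices among the values `g i`, for `i` in `l`. -/
def valueSet (n : ℕ) (g : ℕ → ℕ) (l : List ℕ) : Set (Fin n) := {v | ∃ i ∈ l, g i = v}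

/-- The variables that hold the `j`-th set of guessed vertices. -/
def block (m j : ℕ) : List ℕ := (List.range m).map fun i => 9 + j * m + i

/-- The candidate separator for the values `g` of the guess variables. -/
def candidateOf (m : ℕ) {n : ℕ} (G : SimpleGraph (Fin n)) (g : ℕ → ℕ) : Set (Fin n) :=
  candidate G (valueSet n g [6]) (valueSet n g (block m 0)) (valueSet n g (block m 1))
    (valueSet n g (block m 2)) (valueSet n g (block m 3)) (valueSet n g (block m 4))
    (g 7 = 0) (g 8 = 0)

theorem le_of_mem_block {m j i : ℕ} (h : i ∈ block m j) : 9 ≤ i := by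
  simp only [block, List.mem_map] at h
  obtain ⟨k, -, rfl⟩ := h
  omega

theorem valueSet_congr {n : ℕ} {g g' : ℕ → ℕ} {l : List ℕ} (h : ∀ i ∈ l, g i = g' i) :
    valueSet n g l = valueSet n g' l := by
  ext v
  exact exists_congr fun i => and_congr_right fun hi => by rw [h i hi]

theorem candidateOf_congr {m n : ℕ} {G : SimpleGraph (Fin n)} {g g' : ℕ → ℕ}
    (h : ∀ i ≥ 6, g i = g' i) : candidateOf m G g = candidateOf m G g' := by
  have hb : ∀ j, valueSet n g (block m j) = valueSet n g' (block m j) := fun j =>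
    valueSet_congr fun i hi => h i (by have := le_of_mem_block hi; omega)
  have h6 : valueSet n g [6] = valueSet n g' [6] := valueSet_congr fun i hi => h i (by simp_all)
  simp only [candidateOf, hb, h6, h 7 (by norm_num), h 8 (by norm_num)]

/-- The part of the state that the computation of a candidate keeps. -/
def Keeps (s s' : State) : Prop :=
  s'.var 0 = s.var 0 ∧ (∀ i ≥ 6, s'.var i = s.var i) ∧ s'.arr 0 = s.arr 0 ∧ s'.out = s.out

theorem Agree.keeps {a : ℕ} {s s' : State} (h : Agree a s s') (ha : a ≠ 0) : Keeps s s' :=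
  ⟨h.1, fun i hi => h.2.1 i (by omega), h.2.2.1 0 ha.symm, h.2.2.2⟩

theorem Keeps.trans {s s' s'' : State} (h : Keeps s s') (h' : Keeps s' s'') : Keeps s s'' :=
  ⟨h'.1.trans h.1, fun i hi => (h'.2.1 i hi).trans (h.2.1 i hi), h'.2.2.1.trans h.2.2.1,
    h'.2.2.2.trans h.2.2.2⟩

theorem Keeps.holds {n : ℕ} {G : SimpleGraph (Fin n)} {s s' : State} (hk : Keeps s s')
    (h : Holds G s) : Holds G s' :=
  ⟨hk.1.trans h.1, hk.2.2.1.trans h.2⟩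

/-- The cell of the array `a` that belongs to the vertex in the variable `x`. -/
def Expr.cell (a x : ℕ) : Expr := .read a (.var x) (.const 0)

@[simp] theorem Expr.eval_cell (s : State) (a x : ℕ) :
    (Expr.cell a x).eval s = s.arr a (s.var x) 0 := rfl

/-- Compute the region of the closure procedure in the array `5` and the frame in the array `1`. -/
def regionProg (m : ℕ) : Prog :=
  .seq (setDef 4 (.const 0) (.const 0)
      (.conj (.neg (.memVars 1 (block m 1))) (.neg (.adjVars 1 (block m 1)))))
  (.seq (setDef 1 (.conj (.cell 4 2) (.read 0 (.var 1) (.var 2))) (.const 0)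
      (.add (.conj (.neg (.cell 4 1)) (.var 3)) (.memVars 1 (block m 3))))
    (setDef 5 (.const 0) (.const 0)
      (.conj (.add (.neg (.lt (.var 6) (.var 0))) (.read 0 (.var 1) (.var 6)))
        (.conj (.conj (.neg (.memVars 1 (block m 0))) (.neg (.adjVars 1 (block m 0))))
          (.neg (.cell 1 1))))))

theorem mem_farFrom_iff {n : ℕ} {G : SimpleGraph (Fin n)} {s : State} {l : List ℕ}
    (h : Holds G s) {v : Fin n} (hv : s.var 1 = v) :
    ((Expr.conj (.neg (.memVars 1 l)) (.neg (.adjVars 1 l))).eval s ≠ 0) ↔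
      v ∈ farFrom G (valueSet n s.var l) := by
  simp only [ne_eq, Expr.eval_conj, Expr.eval_neg, Expr.eval_memVars, Expr.eval_adjVars, hv,
    h.adj_iff', not_or, not_not]
  simp only [farFrom, valueSet, Set.mem_ofPred_eq]
  constructor
  · rintro ⟨h1, h2⟩
    exact ⟨fun ⟨i, hi, h⟩ => h1 i hi h.symm, fun z ⟨i, hi, h⟩ => h2 i hi z h⟩
  · rintro ⟨h1, h2⟩
    exact ⟨fun i hi h => h1 ⟨i, hi, h.symm⟩, fun i hi z h => h2 z ⟨i, hi, h⟩⟩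

theorem mem_valueSet_iff {n : ℕ} {s : State} {l : List ℕ} {v : Fin n} (hv : s.var 1 = v) :
    ((Expr.memVars 1 l).eval s = 0) ↔ v ∉ valueSet n s.var l := by
  simp only [Expr.eval_memVars, hv, valueSet, Set.mem_ofPred_eq, not_exists, not_and]
  exact forall_congr' fun i => forall_congr' fun _ => not_congr eq_comm

theorem Keeps.valueSet_eq {n : ℕ} {s s' : State} (h : Keeps s s') {l : List ℕ}
    (hl : ∀ i ∈ l, 6 ≤ i) : valueSet n s'.var l = valueSet n s.var l :=
  valueSet_congr fun i hi => h.2.1 i (hl i hi)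

theorem exec_regionProg (m : ℕ) : ∃ p : Polynomial ℕ, ∀ (n : ℕ) (G : SimpleGraph (Fin n))
    (s : State), Holds G s → ∃ t ≤ p.eval n, ∃ s', Exec (regionProg m) s t s' ∧ Keeps s s' ∧
      Rep s' 1 (frame G (valueSet n s.var (block m 1)) (valueSet n s.var (block m 3))) ∧
      Rep s' 5 (region G (valueSet n s.var [6]) (valueSet n s.var (block m 0))
        (valueSet n s.var (block m 1)) (valueSet n s.var (block m 3))) := by
  have hb : ∀ j, ∀ i ∈ block m j, 6 ≤ i := fun j i hi => by
    have := le_of_mem_block hi; omega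
  obtain ⟨p₁, H₁⟩ := exec_setDef 4 (.const 0) (.const 0)
      (.conj (.neg (.memVars 1 (block m 1))) (.neg (.adjVars 1 (block m 1))))
  obtain ⟨p₂, H₂⟩ := exec_setDef 1 (.conj (.cell 4 2) (.read 0 (.var 1) (.var 2))) (.const 0)
      (.add (.conj (.neg (.cell 4 1)) (.var 3)) (.memVars 1 (block m 3)))
  obtain ⟨p₃, H₃⟩ := exec_setDef 5 (.const 0) (.const 0)
      (.conj (.add (.neg (.lt (.var 6) (.var 0))) (.read 0 (.var 1) (.var 6)))
        (.conj (.conj (.neg (.memVars 1 (block m 0))) (.neg (.adjVars 1 (block m 0))))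
          (.neg (.cell 1 1))))
  refine ⟨p₁ + (p₂ + p₃), fun n G s hs => ?_⟩
  set Y := valueSet n s.var [6]
  set Z := valueSet n s.var (block m 0)
  set Q := valueSet n s.var (block m 1)
  set U := valueSet n s.var (block m 3)
  obtain ⟨t₁, ht₁, s₁, hex₁, hA₁, hR₁⟩ := H₁ n s hs.1 (fun _ _ => False) (fun _ _ => False)
    (fun v _ _ => v ∈ farFrom G Q) (by simp) (by simp) (fun s' hA v hv => by
      rw [mem_farFrom_iff (hA.holds (by norm_num) hs) hv,
        (hA.keeps (by norm_num)).valueSet_eq (hb 1)])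
  have hk₁ := hA₁.keeps (by norm_num)
  have hs₁ := hk₁.holds hs
  obtain ⟨t₂, ht₂, s₂, hex₂, hA₂, hR₂⟩ := H₂ n s₁ hs₁.1 (fun v u => u ∈ farFrom G Q ∧ G.Adj v u)
    (fun _ _ => False) (fun v c _ => v ∉ farFrom G Q ∧ c ∨ v ∈ U)
    (fun s' hA v u hv hu => by
      simp only [ne_eq, Expr.eval_conj, Expr.eval_cell, Expr.eval_read, Expr.eval_var, hv, hu,
        (hA.rep (by norm_num) hR₁).eq_zero_iff, (hA.holds (by norm_num) hs₁).adj_iff]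
      simp)
    (by simp)
    (fun s' hA v hv => by
      rw [ne_eq, Expr.eval_add, mem_valueSet_iff hv,
        (hk₁.trans (hA.keeps (by norm_num))).valueSet_eq (hb 3)]
      simp only [Expr.eval_conj, Expr.eval_neg, Expr.eval_cell, hv, Expr.eval_var,
        ne_eq, (hA.rep (by norm_num) hR₁).eq_zero_iff]
      simp only [Set.mem_ofPred_eq]
      tauto)
  have hk₂ := hk₁.trans (hA₂.keeps (by norm_num))
  have hs₂ := hk₂.holds hs
  have hR₂' : Rep s₂ 1 (frame G Q U) := fun v => hR₂ v
  obtain ⟨t₃, ht₃, s₃, hex₃, hA₃, hR₃⟩ := H₃ n s₂ hs₂.1 (fun _ _ => False) (fun _ _ => False)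
    (fun v _ _ => v ∈ region G Y Z Q U) (by simp) (by simp)
    (fun s' hA v hv => by
      have hk := hk₂.trans (hA.keeps (by norm_num))
      have hh := hk.holds hs
      have hfar := mem_farFrom_iff (l := block m 0) hh hv
      rw [hk.valueSet_eq (hb 0)] at hfar
      -- If variable `6` holds the dummy value, `Y` is empty and the condition is vacuous; the
      -- comparison with `n` covers this.
      have hy : ((Expr.add (.neg (.lt (.var 6) (.var 0)))
          (.read 0 (.var 1) (.var 6))).eval s' ≠ 0) ↔ ∀ y ∈ Y, G.Adj v y := by
        have h6 : s'.var 6 = s.var 6 := hk.2.1 6 (by norm_num)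
        simp only [ne_eq, Expr.eval_add, Expr.eval_neg, Expr.eval_read, Expr.eval_lt, Expr.eval_var,
          hv, hh.adj_iff', hh.1, h6, not_not]
        simp only [Y, valueSet, List.mem_singleton, exists_eq_left, Set.mem_ofPred_eq]
        constructor
        · intro h y hy
          by_contra hvy
          exact h ⟨by simp [hy], fun w hw => by rwa [← Fin.ext (hy.symm.trans hw)]⟩
        · rintro h ⟨h1, h2⟩
          exact h2 ⟨_, h1⟩ rfl (h ⟨_, h1⟩ rfl)
      rw [ne_eq, Expr.eval_conj, not_or, ← ne_eq, hy, Expr.eval_conj, not_or, ← ne_eq, hfar,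
        Expr.eval_neg, Expr.eval_cell, hv, not_not, (hA.rep (by norm_num) hR₂').eq_zero_iff]
      rfl)
  refine ⟨t₁ + (t₂ + t₃), ?_, s₃, Exec.seq hex₁ (Exec.seq hex₂ hex₃),
    hk₂.trans (hA₃.keeps (by norm_num)), hA₃.rep (by norm_num) hR₂', hR₃⟩
  simp only [Polynomial.eval_add]
  omega

/-- Run the closure procedure, in the array `2`. -/
def closureProg (m : ℕ) : Prog :=
  .seq (setDef 2 (.const 0) (.const 0) (.memVars 1 (block m 4)))
    (forLoop 5 (.var 0) (.seq
      (setDef 3 (.conj (.cell 2 2) (.read 0 (.var 1) (.var 2)))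
        (.conj (.cell 2 2) (.neg (.read 0 (.var 1) (.var 2))))
        (.add (.cell 2 1) (.conj (.cell 5 1) (.conj (.add (.eq (.var 7) (.const 0)) (.var 3))
          (.add (.eq (.var 8) (.const 0)) (.var 4))))))
      (setDef 2 (.const 0) (.const 0) (.cell 3 1))))

theorem exec_closureProg (m : ℕ) : ∃ p : Polynomial ℕ, ∀ (n : ℕ) (G : SimpleGraph (Fin n))
    (s : State) (R F : Set (Fin n)), Holds G s → Rep s 5 R → Rep s 1 F →
      ∃ t ≤ p.eval n, ∃ s', Exec (closureProg m) s t s' ∧ Keeps s s' ∧ Rep s' 1 F ∧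
      Rep s' 2 (closureIn G R (s.var 7 = 0) (s.var 8 = 0) (valueSet n s.var (block m 4))) := by
  have hb : ∀ j, ∀ i ∈ block m j, 6 ≤ i := fun j i hi => by
    have := le_of_mem_block hi; omega
  obtain ⟨p₁, H₁⟩ := exec_setDef 2 (.const 0) (.const 0) (.memVars 1 (block m 4))
  obtain ⟨p₂, H₂⟩ := exec_setDef 3 (.conj (.cell 2 2) (.read 0 (.var 1) (.var 2)))
        (.conj (.cell 2 2) (.neg (.read 0 (.var 1) (.var 2))))
        (.add (.cell 2 1) (.conj (.cell 5 1) (.conj (.add (.eq (.var 7) (.const 0)) (.var 3))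
          (.add (.eq (.var 8) (.const 0)) (.var 4)))))
  obtain ⟨p₃, H₃⟩ := exec_setDef 2 (.const 0) (.const 0) (.cell 3 1)
  refine ⟨p₁ + (.X * (p₂ + p₃ + .C 8) + .C 6), fun n G s R F hs hR hF => ?_⟩
  set b₁ := s.var 7 = 0 with hb₁
  set b₂ := s.var 8 = 0 with hb₂
  set X := valueSet n s.var (block m 4) with hX
  obtain ⟨t₁, ht₁, s₁, hex₁, hA₁, hR₁⟩ := H₁ n s hs.1 (fun _ _ => False) (fun _ _ => False)
    (fun v _ _ => v ∈ X) (by simp) (by simp) (fun s' hA v hv => by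
      rw [ne_eq, mem_valueSet_iff hv, (hA.keeps (by norm_num)).valueSet_eq (hb 4), not_not])
  have hk₁ := hA₁.keeps (by norm_num)
  let I : ℕ → State → Prop := fun i s' => Keeps s s' ∧ s'.var 5 = i ∧ Rep s' 5 R ∧ Rep s' 1 F ∧
    Rep s' 2 ((closureStep G R b₁ b₂)^[i] X)
  suffices hstep : ∀ i < n, ∀ s', I i s' → ∃ t ≤ p₂.eval n + p₃.eval n, ∃ s'', Exec (.seq
      (setDef 3 (.conj (.cell 2 2) (.read 0 (.var 1) (.var 2)))
        (.conj (.cell 2 2) (.neg (.read 0 (.var 1) (.var 2))))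
        (.add (.cell 2 1) (.conj (.cell 5 1) (.conj (.add (.eq (.var 7) (.const 0)) (.var 3))
          (.add (.eq (.var 8) (.const 0)) (.var 4))))))
      (setDef 2 (.const 0) (.const 0) (.cell 3 1))) s' t s'' ∧
        I (i + 1) (s''.setVar 5 (s''.var 5 + 1)) by
    obtain ⟨t₂, ht₂, s₂, hex₂, hk₂, -, -, hF₂, hX₂⟩ := exec_forLoop (hi := .var 0) I (s := s₁)
      ⟨⟨(State.setVar_var_of_ne _ _ (by norm_num)).trans hk₁.1, fun i hi =>
        (State.setVar_var_of_ne _ _ (by omega)).trans (hk₁.2.1 i hi), hk₁.2.2.1, hk₁.2.2.2⟩,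
        State.setVar_var_self _ _ _, hA₁.rep (by norm_num) hR, hA₁.rep (by norm_num) hF, hR₁⟩
      (fun i s' hs' => ⟨hs'.2.1, hs'.1.1.trans hs.1⟩) hstep
    refine ⟨t₁ + t₂, ?_, s₂, Exec.seq hex₁ hex₂, hk₂, hF₂, ?_⟩
    · simp only [Expr.cost] at ht₂
      simp only [Polynomial.eval_add, Polynomial.eval_mul, Polynomial.eval_X, Polynomial.eval_C]
      refine Nat.add_le_add ht₁ (ht₂.trans (le_of_eq ?_))
      ring
    · unfold closureIn
      rwa [Nat.card_eq_fintype_card, Fintype.card_fin]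
  intro i hi s' ⟨hk, h5, hR', hF', hX'⟩
  have hs' := hk.holds hs
  set X' := (closureStep G R b₁ b₂)^[i] X with hX'def
  obtain ⟨t₂, ht₂, s₂, hex₂, hA₂, hR₂⟩ := H₂ n s' hs'.1 (fun v u => u ∈ X' ∧ G.Adj v u)
    (fun v u => u ∈ X' ∧ ¬ G.Adj v u)
    (fun v c₁ c₂ => v ∈ X' ∨ v ∈ R ∧ (b₁ ∨ c₁) ∧ (b₂ ∨ c₂))
    (fun s'' hA v u hv hu => by
      simp only [ne_eq, Expr.eval_conj, Expr.eval_cell, Expr.eval_read, Expr.eval_var, hv, hu,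
        (hA.rep (by norm_num) hX').eq_zero_iff, (hA.holds (by norm_num) hs').adj_iff]
      simp)
    (fun s'' hA v u hv hu => by
      simp only [ne_eq, Expr.eval_conj, Expr.eval_cell, Expr.eval_neg, Expr.eval_read,
        Expr.eval_var, hv, hu, (hA.rep (by norm_num) hX').eq_zero_iff,
        (hA.holds (by norm_num) hs').adj_iff]
      simp)
    (fun s'' hA v hv => by
      have hk' := hk.trans (hA.keeps (by norm_num))
      simp only [ne_eq, Expr.eval_add, Expr.eval_conj, Expr.eval_cell, Expr.eval_eq,
        Expr.eval_const, Expr.eval_var, hv, (hA.rep (by norm_num) hX').eq_zero_iff,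
        (hA.rep (by norm_num) hR').eq_zero_iff, hk'.2.1 7 (by norm_num), hk'.2.1 8 (by norm_num),
        ← hb₁, ← hb₂]
      tauto)
  have hk₂ := hk.trans (hA₂.keeps (by norm_num))
  have hs₂ := hk₂.holds hs
  -- The new round is built in array `3` from the old one in array `2`, and only then copied back.
  have hR₂' : Rep s₂ 3 ((closureStep G R b₁ b₂)^[i + 1] X) := by
    rw [Function.iterate_succ_apply']
    exact hR₂
  obtain ⟨t₃, ht₃, s₃, hex₃, hA₃, hR₃⟩ := H₃ n s₂ hs₂.1 (fun _ _ => False) (fun _ _ => False)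
    (fun v _ _ => v ∈ (closureStep G R b₁ b₂)^[i + 1] X) (by simp) (by simp)
    (fun s'' hA v hv => by
      rw [Expr.eval_cell, hv]
      exact hA.rep (by norm_num) hR₂' v)
  have hk₃ := hk₂.trans (hA₃.keeps (by norm_num))
  refine ⟨t₂ + t₃, by omega, s₃, Exec.seq hex₂ hex₃,
    ⟨(State.setVar_var_of_ne _ _ (by norm_num)).trans hk₃.1, fun i hi =>
      (State.setVar_var_of_ne _ _ (by omega)).trans (hk₃.2.1 i hi), hk₃.2.2.1, hk₃.2.2.2⟩, ?_,
    hA₃.rep (by norm_num) (hA₂.rep (by norm_num) hR'),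
    hA₃.rep (by norm_num) (hA₂.rep (by norm_num) hF'), hR₃⟩
  rw [State.setVar_var_self, hA₃.2.1 5 le_rfl, hA₂.2.1 5 le_rfl, h5]

/-- From the closure in the array `2` and the frame in the array `1`, compute the candidate in the
array `7`. -/
def separatorProg (m : ℕ) : Prog :=
  .seq (setDef 6 (.const 0) (.const 0) (.add (.cell 2 1) (.memVars 1 (block m 2))))
    (setDef 7 (.conj (.cell 6 2) (.read 0 (.var 1) (.var 2))) (.const 0)
      (.add (.conj (.neg (.cell 6 1)) (.var 3)) (.cell 1 1)))

theorem exec_separatorProg (m : ℕ) : ∃ p : Polynomial ℕ, ∀ (n : ℕ) (G : SimpleGraph (Fin n))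
    (s : State) (X F : Set (Fin n)), Holds G s → Rep s 2 X → Rep s 1 F →
      ∃ t ≤ p.eval n, ∃ s', Exec (separatorProg m) s t s' ∧ Keeps s s' ∧
      Rep s' 7 (nbhd G (X ∪ valueSet n s.var (block m 2)) ∪ F) := by
  have hb : ∀ j, ∀ i ∈ block m j, 6 ≤ i := fun j i hi => by
    have := le_of_mem_block hi; omega
  obtain ⟨p₁, H₁⟩ := exec_setDef 6 (.const 0) (.const 0)
    (.add (.cell 2 1) (.memVars 1 (block m 2)))
  obtain ⟨p₂, H₂⟩ := exec_setDef 7 (.conj (.cell 6 2) (.read 0 (.var 1) (.var 2))) (.const 0)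
      (.add (.conj (.neg (.cell 6 1)) (.var 3)) (.cell 1 1))
  refine ⟨p₁ + p₂, fun n G s X F hs hX hF => ?_⟩
  set W := valueSet n s.var (block m 2)
  obtain ⟨t₁, ht₁, s₁, hex₁, hA₁, hR₁⟩ := H₁ n s hs.1 (fun _ _ => False) (fun _ _ => False)
    (fun v _ _ => v ∈ X ∪ W) (by simp) (by simp) (fun s' hA v hv => by
      rw [ne_eq, Expr.eval_add, mem_valueSet_iff hv, (hA.keeps (by norm_num)).valueSet_eq (hb 2),
        Expr.eval_cell, hv, (hA.rep (by norm_num) hX).eq_zero_iff, Set.mem_union]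
      tauto)
  have hk₁ := hA₁.keeps (by norm_num)
  have hs₁ := hk₁.holds hs
  obtain ⟨t₂, ht₂, s₂, hex₂, hA₂, hR₂⟩ := H₂ n s₁ hs₁.1 (fun v u => u ∈ X ∪ W ∧ G.Adj v u)
    (fun _ _ => False) (fun v c _ => v ∉ X ∪ W ∧ c ∨ v ∈ F)
    (fun s' hA v u hv hu => by
      simp only [ne_eq, Expr.eval_conj, Expr.eval_cell, Expr.eval_read, Expr.eval_var, hv, hu,
        (hA.rep (by norm_num) hR₁).eq_zero_iff, (hA.holds (by norm_num) hs₁).adj_iff]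
      rw [not_or, not_not, not_not]
      rfl)
    (by simp)
    (fun s' hA v hv => by
      simp only [ne_eq, Expr.eval_add, Expr.eval_conj, Expr.eval_neg, Expr.eval_cell, hv,
        Expr.eval_var, (hA.rep (by norm_num) hR₁).eq_zero_iff,
        (hA.rep (by norm_num) (hA₁.rep (by norm_num) hF)).eq_zero_iff]
      simp only [Set.mem_ofPred_eq]
      tauto)
  refine ⟨t₁ + t₂, ?_, s₂, Exec.seq hex₁ hex₂, hk₁.trans (hA₂.keeps (by norm_num)), ?_⟩
  · simp only [Polynomial.eval_add]
    omega
  · exact fun v => hR₂ v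

/-- Output the set in the array `7`. -/
def outputProg : Prog :=
  .seq .newList (forLoop 1 (.var 0) (.ite (.cell 7 1) (.put (.var 1)) .skip))

theorem exec_outputProg : ∃ p : Polynomial ℕ, ∀ (n : ℕ) (G : SimpleGraph (Fin n))
    (s : State) (X : Set (Fin n)), Holds G s → Rep s 7 X →
      ∃ t ≤ p.eval n, ∃ s', Exec outputProg s t s' ∧ Holds G s' ∧
      (∀ i ≥ 6, s'.var i = s.var i) ∧ ∃ l : List ℕ, s'.out = l :: s.out ∧ (∀ x ∈ l, x < n) ∧
        X = {v : Fin n | (v : ℕ) ∈ l} := by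
  refine ⟨.X * .C 14 + .C 7, fun n G s X hs hX => ?_⟩
  let I : ℕ → State → Prop := fun i s' => Holds G s' ∧ (∀ i ≥ 6, s'.var i = s.var i) ∧
    s'.var 1 = i ∧ Rep s' 7 X ∧ ∃ l : List ℕ, s'.out = l :: s.out ∧ (∀ x ∈ l, x < i) ∧
      ∀ v : Fin n, v.1 < i → ((v : ℕ) ∈ l ↔ v ∈ X)
  suffices hstep : ∀ i < n, ∀ s', I i s' → ∃ t ≤ 6, ∃ s'',
      Exec (.ite (.cell 7 1) (.put (.var 1)) .skip) s' t s'' ∧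
        I (i + 1) (s''.setVar 1 (s''.var 1 + 1)) by
    obtain ⟨t, ht, s', hex, hs', hvar, -, -, l, hout, hl, hmem⟩ := exec_forLoop (hi := .var 0) I
      (s := { s with out := [] :: s.out })
      ⟨⟨(State.setVar_var_of_ne _ _ (by norm_num)).trans hs.1, hs.2⟩,
        fun i hi => State.setVar_var_of_ne _ _ (by omega), State.setVar_var_self _ _ _, hX,
        [], rfl, by simp, fun v hv => absurd hv (Nat.not_lt_zero _)⟩
      (fun i s' hs' => ⟨hs'.2.2.1, hs'.1.1⟩) hstep
    refine ⟨1 + t, ?_, s', Exec.seq (Exec.newList _) hex, hs', hvar, l, hout, hl, ?_⟩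
    · simp only [Expr.cost] at ht
      simp only [Polynomial.eval_add, Polynomial.eval_mul, Polynomial.eval_X, Polynomial.eval_C]
      omega
    · ext v
      exact (hmem v v.2).symm
  intro i hi s' ⟨hs', hvar, h1, hX', l, hout, hl, hmem⟩
  have hmem' : ∀ v : Fin n, v.1 < i + 1 → (v : ℕ) ≠ i → ((v : ℕ) ∈ l ↔ v ∈ X) :=
    fun v hv hne => hmem v (by omega)
  by_cases hc : s'.arr 7 i 0 = 0
  · refine ⟨_, ?_, s', Exec.ite_false (by rw [Expr.eval_cell, h1, hc]) (Exec.skip _),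
      ⟨(State.setVar_var_of_ne _ _ (by norm_num)).trans hs'.1, hs'.2⟩,
      fun j hj => (State.setVar_var_of_ne _ _ (by omega)).trans (hvar j hj), ?_, hX', l, hout,
      fun x hx => (hl x hx).trans (Nat.lt_succ_self i), fun v hv => ?_⟩
    · simp [Expr.cost, Expr.cell]
    · rw [State.setVar_var_self, h1]
    · by_cases hvi : (v : ℕ) = i
      · have hvX : v ∉ X := by
          rw [← hX' v, not_not, hvi, hc]
        exact ⟨fun h => absurd (hl _ h) (by omega), fun h => absurd h hvX⟩
      · exact hmem' v hv hvi
  · refine ⟨_, ?_, _, Exec.ite_true (by rw [Expr.eval_cell, h1]; exact hc) (Exec.put _ _),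
      ⟨(State.setVar_var_of_ne _ _ (by norm_num)).trans hs'.1, hs'.2⟩,
      fun j hj => (State.setVar_var_of_ne _ _ (by omega)).trans (hvar j hj), ?_, hX', i :: l, ?_,
      fun x hx => ?_, fun v hv => ?_⟩
    · simp [Expr.cost, Expr.cell]
    · rw [State.setVar_var_self, h1]
    · simp [hout, putOut, h1]
    · rcases List.mem_cons.1 hx with rfl | hx
      · exact Nat.lt_succ_self _
      · exact (hl x hx).trans (Nat.lt_succ_self i)
    · rw [List.mem_cons]
      by_cases hvi : (v : ℕ) = i
      · refine iff_of_true (Or.inl hvi) ?_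
        rw [← hX' v, hvi]
        exact hc
      · rw [← hmem' v hv hvi]
        simp [hvi]

/-- Compute and output the candidate for the current values of the guess variables. -/
def candidateProg (m : ℕ) : Prog :=
  .seq (regionProg m) (.seq (closureProg m) (.seq (separatorProg m) outputProg))

theorem exec_candidateProg (m : ℕ) : ∃ p : Polynomial ℕ, ∀ (n : ℕ) (G : SimpleGraph (Fin n))
    (s : State), Holds G s → ∃ t ≤ p.eval n, ∃ s', Exec (candidateProg m) s t s' ∧ Holds G s' ∧
      (∀ i ≥ 6, s'.var i = s.var i) ∧ ∃ l : List ℕ, s'.out = l :: s.out ∧ (∀ x ∈ l, x < n) ∧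
        candidateOf m G s.var = {v : Fin n | (v : ℕ) ∈ l} := by
  obtain ⟨p₁, H₁⟩ := exec_regionProg m
  obtain ⟨p₂, H₂⟩ := exec_closureProg m
  obtain ⟨p₃, H₃⟩ := exec_separatorProg m
  obtain ⟨p₄, H₄⟩ := exec_outputProg
  refine ⟨p₁ + (p₂ + (p₃ + p₄)), fun n G s hs => ?_⟩
  have hb : ∀ j, ∀ i ∈ block m j, 6 ≤ i := fun j i hi => by
    have := le_of_mem_block hi; omega
  obtain ⟨t₁, ht₁, s₁, hex₁, hk₁, hF₁, hR₁⟩ := H₁ n G s hs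
  obtain ⟨t₂, ht₂, s₂, hex₂, hk₂, hF₂, hX₂⟩ := H₂ n G s₁ _ _ (hk₁.holds hs) hR₁ hF₁
  have hk₂' := hk₁.trans hk₂
  obtain ⟨t₃, ht₃, s₃, hex₃, hk₃, hS₃⟩ := H₃ n G s₂ _ _ (hk₂'.holds hs) hX₂ hF₂
  have hk₃' := hk₂'.trans hk₃
  obtain ⟨t₄, ht₄, s₄, hex₄, hs₄, hvar, l, hout, hl, hX⟩ := H₄ n G s₃ _ (hk₃'.holds hs) hS₃
  refine ⟨t₁ + (t₂ + (t₃ + t₄)), ?_, s₄, Exec.seq hex₁ (Exec.seq hex₂ (Exec.seq hex₃ hex₄)), hs₄,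
    fun i hi => (hvar i hi).trans (hk₃'.2.1 i hi), l, by rw [hout, hk₃'.2.2.2], hl, ?_⟩
  · simp only [Polynomial.eval_add]
    omega
  · rw [← hX, hk₁.2.1 7 (by norm_num), hk₁.2.1 8 (by norm_num), hk₁.valueSet_eq (hb 4),
      hk₂'.valueSet_eq (hb 2)]
    rfl

/-! ### Enumeration of all guesses -/

/-- Run `c` for all values `0, …, n` of the variables in `l`. -/
def enumProg (c : Prog) : List ℕ → Prog
  | [] => c
  | x :: l => forLoop x (.add (.var 0) (.const 1)) (enumProg c l)

theorem exec_enumProg (m : ℕ) (l : List ℕ) (hl : ∀ i ∈ l, 6 ≤ i) (hnd : l.Nodup) :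
    ∃ p : Polynomial ℕ, ∀ (n : ℕ) (G : SimpleGraph (Fin n)) (s : State), Holds G s →
      (∀ L ∈ s.out, ∀ x ∈ L, x < n) →
      ∃ t ≤ p.eval n, ∃ s', Exec (enumProg (candidateProg m) l) s t s' ∧ Holds G s' ∧
        (∀ i ≥ 6, i ∉ l → s'.var i = s.var i) ∧ (∀ L ∈ s'.out, ∀ x ∈ L, x < n) ∧ s.out ⊆ s'.out ∧
        ∀ g : ℕ → ℕ, (∀ i ∈ l, g i ≤ n) → (∀ i ≥ 6, i ∉ l → g i = s.var i) →
          ∃ L ∈ s'.out, candidateOf m G g = {v : Fin n | (v : ℕ) ∈ L} := by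
  induction l with
  | nil =>
    obtain ⟨p, H⟩ := exec_candidateProg m
    refine ⟨p, fun n G s hs hout => ?_⟩
    obtain ⟨t, ht, s', hex, hs', hvar, L, hL, hLn, hc⟩ := H n G s hs
    refine ⟨t, ht, s', hex, hs', fun i hi _ => hvar i hi, ?_, ?_, fun g _ hg => ⟨L, ?_, ?_⟩⟩
    · rw [hL]
      rintro L' hL' x hx
      rcases List.mem_cons.1 hL' with rfl | hL'
      · exact hLn x hx
      · exact hout L' hL' x hx
    · rw [hL]
      exact List.subset_cons_self _ _
    · rw [hL]
      exact List.mem_cons_self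
    · rw [← hc]
      exact candidateOf_congr fun i hi => hg i hi (by simp)
  | cons x l ih =>
    obtain ⟨p, H⟩ := ih (fun i hi => hl i (List.mem_cons_of_mem _ hi)) hnd.of_cons
    have hx6 : 6 ≤ x := hl x List.mem_cons_self
    have hxl : x ∉ l := (List.nodup_cons.1 hnd).1
    refine ⟨(.X + .C 1) * (p + .C 10) + .C 8, fun n G s hs hout => ?_⟩
    -- After `i` rounds, the output covers all assignments whose value at `x` is below `i`; the
    -- bound `n + 1` of the loop admits the dummy value `n`.
    let I : ℕ → State → Prop := fun i s' => Holds G s' ∧ s'.var x = i ∧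
      (∀ j ≥ 6, j ∉ x :: l → s'.var j = s.var j) ∧ (∀ L ∈ s'.out, ∀ x ∈ L, x < n) ∧
      s.out ⊆ s'.out ∧ ∀ g : ℕ → ℕ, (∀ j ∈ l, g j ≤ n) → g x < i →
        (∀ j ≥ 6, j ∉ x :: l → g j = s.var j) →
          ∃ L ∈ s'.out, candidateOf m G g = {v : Fin n | (v : ℕ) ∈ L}
    suffices hstep : ∀ i < n + 1, ∀ s', I i s' → ∃ t ≤ p.eval n, ∃ s'',
        Exec (enumProg (candidateProg m) l) s' t s'' ∧
          I (i + 1) (s''.setVar x (s''.var x + 1)) by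
      obtain ⟨t, ht, s', hex, hs', -, hvar, hout', hsub, hg⟩ :=
        exec_forLoop (hi := .add (.var 0) (.const 1)) I (s := s)
        ⟨⟨(State.setVar_var_of_ne _ _ (by omega)).trans hs.1, hs.2⟩, State.setVar_var_self _ _ _,
          fun j hj hjl => State.setVar_var_of_ne _ _ (fun h => hjl (by simp [h])), hout,
          List.Subset.refl _, fun g _ h _ => absurd h (Nat.not_lt_zero _)⟩
        (fun i s' hs' => ⟨hs'.2.1, by simp [Expr.eval, hs'.1.1]⟩) hstep
      refine ⟨t, ht.trans (le_of_eq ?_), s', hex, hs', hvar, hout', hsub, fun g h1 h2 =>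
        hg g (fun j hj => h1 j (List.mem_cons_of_mem _ hj))
          (Nat.lt_succ_of_le (h1 x List.mem_cons_self)) h2⟩
      simp only [Expr.cost, Polynomial.eval_add, Polynomial.eval_mul, Polynomial.eval_X,
        Polynomial.eval_C]
      ring
    intro i hi s' ⟨hs', hxi, hvar, hout', hsub, hg⟩
    obtain ⟨t, ht, s'', hex, hs'', hvar', hout'', hsub', hg'⟩ := H n G s' hs' hout'
    have hx'' : s''.var x = i := (hvar' x hx6 hxl).trans hxi
    refine ⟨t, ht, s'', hex, ⟨(State.setVar_var_of_ne _ _ (by omega)).trans hs''.1, hs''.2⟩, ?_, ?_,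
      hout'', List.Subset.trans hsub hsub', ?_⟩
    · rw [State.setVar_var_self, hx'']
    · intro j hj hjl
      have hjx : j ≠ x := fun h => hjl (by simp [h])
      rw [State.setVar_var_of_ne _ _ hjx, hvar' j hj fun h => hjl (List.mem_cons_of_mem _ h),
        hvar j hj hjl]
    · intro g h1 h2 h3
      rcases Nat.lt_succ_iff_lt_or_eq.1 h2 with h2 | h2
      · obtain ⟨L, hL, hc⟩ := hg g h1 h2 h3
        exact ⟨L, hsub' hL, hc⟩
      · refine hg' g h1 fun j hj hjl => ?_
        by_cases hjx : j = x
        · rw [hjx, h2, hxi]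
        · have : j ∉ x :: l := by simp [hjx, hjl]
          rw [h3 j hj this, hvar j hj this]

/-- Every small set of vertices is listed by `m` numbers, where the number `n` stands for none. -/
theorem exists_values {n m : ℕ} {X : Set (Fin n)} (hX : X.ncard ≤ m) :
    ∃ f : ℕ → ℕ, (∀ i, f i ≤ n) ∧ ∀ v : Fin n, v ∈ X ↔ ∃ i < m, f i = v := by
  classical
  let L : List ℕ := X.toFinset.toList.map Fin.val
  have hL : L.length ≤ m := by
    simp only [L, List.length_map, Finset.length_toList]
    rwa [← Set.ncard_eq_toFinset_card']
  have hLX : ∀ v : Fin n, v ∈ X ↔ (v : ℕ) ∈ L := fun v => by simp [L, Fin.val_inj]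
  refine ⟨fun i => L.getD i n, fun i => ?_, fun v => ?_⟩
  · by_cases hi : i < L.length
    · have hmem : L[i] ∈ L := List.getElem_mem hi
      simp only [List.getD_eq_getElem?_getD, List.getElem?_eq_getElem hi, Option.getD_some]
      obtain ⟨w, -, hw⟩ := List.mem_map.1 hmem
      rw [← hw]
      exact w.2.le
    · simp [List.getD_eq_getElem?_getD, List.getElem?_eq_none (not_lt.1 hi)]
  · rw [hLX]
    constructor
    · intro hv
      obtain ⟨i, hi, hiv⟩ := List.getElem_of_mem hv
      exact ⟨i, hi.trans_le hL, by simp [List.getD_eq_getElem?_getD, hi, hiv]⟩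
    · rintro ⟨i, -, hi⟩
      by_cases hlt : i < L.length
      · rw [← hi]
        simp [List.getD_eq_getElem?_getD, hlt]
      · simp only [List.getD_eq_getElem?_getD, List.getElem?_eq_none (not_lt.1 hlt),
          Option.getD_none] at hi
        exact absurd v.2 (by omega)

/-- All choices of guesses occur as values of the guess variables. -/
theorem exists_guess {m n : ℕ} (hn : 0 < n) (G : SimpleGraph (Fin n))
    {Y Z Q W U X : Set (Fin n)} {b₁ b₂ : Prop} (hY : Y.ncard ≤ 1) (hZ : Z.ncard ≤ m)
    (hQ : Q.ncard ≤ m) (hW : W.ncard ≤ m) (hU : U.ncard ≤ m) (hX : X.ncard ≤ m) :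
    ∃ g : ℕ → ℕ, (∀ i, g i ≤ n) ∧ (∀ i ≥ 9 + 5 * m, g i = 0) ∧
      candidateOf m G g = candidate G Y Z Q W U X b₁ b₂ := by
  classical
  obtain ⟨fY, hfY, hY⟩ := exists_values hY
  have hS : ∀ j : ℕ, ∃ f : ℕ → ℕ, (∀ i, f i ≤ n) ∧
      ∀ v : Fin n, v ∈ (![Z, Q, W, U, X] (Fin.ofNat 5 j)) ↔ ∃ i < m, f i = v := by
    intro j
    apply exists_values
    generalize Fin.ofNat 5 j = k
    fin_cases k <;> assumption
  choose f hf hfS using hS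
  -- The flags are stored inverted, with `0` meaning true. Division with remainder by `m` locates
  -- the block of a variable and the place in it.
  let g : ℕ → ℕ := fun i => if i = 6 then fY 0 else if i = 7 then (if b₁ then 0 else 1) else
    if i = 8 then (if b₂ then 0 else 1) else
      if i < 9 + 5 * m then f ((i - 9) / m) ((i - 9) % m) else 0
  have hblock : ∀ j < 5, ∀ i < m, g (9 + j * m + i) = f j i := by
    intro j hj i hi
    have hlt : j * m + i < 5 * m := by nlinarith
    have hdiv : (j * m + i) / m = j := by
      rw [Nat.mul_comm, Nat.mul_add_div (by omega), Nat.div_eq_of_lt hi, Nat.add_zero]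
    have hmod : (j * m + i) % m = i := by
      rw [Nat.mul_comm, Nat.mul_add_mod, Nat.mod_eq_of_lt hi]
    simp only [g]
    rw [if_neg (by omega), if_neg (by omega), if_neg (by omega), if_pos (by omega),
      show 9 + j * m + i - 9 = j * m + i by omega, hdiv, hmod]
  have hval : ∀ j < 5, valueSet n g (block m j) = ![Z, Q, W, U, X] (Fin.ofNat 5 j) := by
    intro j hj
    ext v
    rw [hfS j v]
    simp only [valueSet, block, List.mem_map, List.mem_range, Set.mem_ofPred_eq]
    constructor
    · rintro ⟨_, ⟨i, hi, rfl⟩, h⟩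
      exact ⟨i, hi, by rw [← hblock j hj i hi, h]⟩
    · rintro ⟨i, hi, h⟩
      exact ⟨_, ⟨i, hi, rfl⟩, by rw [hblock j hj i hi, h]⟩
  refine ⟨g, fun i => ?_, fun i hi => ?_, ?_⟩
  · simp only [g]
    split_ifs <;> first | exact hfY _ | exact hf _ _ | omega
  · simp only [g]
    rw [if_neg (by omega), if_neg (by omega), if_neg (by omega), if_neg (by omega)]
  · have h6 : valueSet n g [6] = Y := by
      ext v
      rw [hY]
      simp [valueSet, g]
    have h7 : (g 7 = 0) = b₁ := by simp [g]
    have h8 : (g 8 = 0) = b₂ := by simp [g]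
    rw [candidateOf, h6, h7, h8, hval 0 (by norm_num), hval 1 (by norm_num), hval 2 (by norm_num),
      hval 3 (by norm_num), hval 4 (by norm_num)]
    rfl

/-- The variables over whose values the algorithm loops. -/
def guessVars (m : ℕ) : List ℕ := List.range' 6 (5 * m + 3)

end Algorithm

end SepCarving

/-! ### The algorithm and its correctness -/

theorem mainTheorem6 (d : ℕ) (hd : 0 < d) :
    ∃ (c : SepCarving.Prog) (p : Polynomial ℕ),
      ∀ (n : ℕ) (G : SimpleGraph (Fin n)), SepCarving.P6Free G →
        ∃ 𝓢 : Set (Set (Fin n)), SepCarving.ReturnsWithin c G (p.eval n) 𝓢 ∧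
          ∀ T : SepCarving.RootedForest (Fin n), T.IsMaximalTDStructure G d →
            ∀ S : Set (Fin n), T.IsAvoidingMinSep G d S →
              ∃ S' ∈ 𝓢, T.IsCarver G S S' := by
  obtain ⟨p, H⟩ := SepCarving.exec_enumProg (d + 10) (SepCarving.guessVars (d + 10))
    (fun i hi => (List.mem_range'_1.1 hi).1) List.nodup_range'
  refine ⟨SepCarving.enumProg (SepCarving.candidateProg (d + 10)) (SepCarving.guessVars (d + 10)),
    p, fun n G hG => ?_⟩
  obtain ⟨t, ht, s, hex, -, -, hout, -, hg⟩ := H n G (SepCarving.inputState G)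
    ⟨by simp [SepCarving.inputState], rfl⟩ (by simp [SepCarving.inputState])
  refine ⟨_, ⟨t, ht, s, hex, hout, rfl⟩, fun T hT S hS => ?_⟩
  obtain ⟨Y, Z, Q, W, U, X, b₁, b₂, hY, hZ, hQ, hW, hU, hX, hcarver⟩ :=
    SepCarving.exists_carver_candidate hG hT.1 hS.1 hS.2.1
  -- The flags need the value `1`, while guesses range only up to `n`; the separator guarantees that
  -- there is a vertex.
  have hn : 0 < n := by
    obtain ⟨A, -, -, hA, -⟩ := hS.1
    obtain ⟨v, -⟩ := hA.1.nonempty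
    exact v.pos
  obtain ⟨g, hgn, hg0, hgc⟩ := SepCarving.exists_guess hn G (b₁ := b₁) (b₂ := b₂) hY hZ hQ hW hU hX
  -- Outside the enumerated variables, `g` has to agree with the input state, where every variable
  -- from `6` on is zero.
  obtain ⟨L, hL, hLc⟩ := hg g (fun i _ => hgn i) fun i hi hil => by
    have : ¬ i < 6 + (5 * (d + 10) + 3) := fun h => hil (List.mem_range'_1.2 ⟨hi, h⟩)
    rw [hg0 i (by omega)]
    simp [SepCarving.inputState]
    omega
  refine ⟨_, ⟨L, hL, rfl⟩, ?_⟩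
  rw [← hLc, hgc]
  exact hcarver
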